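/- **Conventions.** Let $\mathcal D\subset\mathbb R^2$ be open and let $x=x(u,v)$ be a regular surface in Euclidean space $\mathbb R^3$, of class $C^2$ at least, with coefficients $E,F,G$ of the first fundamental form. Fix signs $\varepsilon,\delta\in\{1,-1\}$ that orient the parametric lines, and put $$X=\varepsilon\,\frac{x_u}{\sqrt E},\qquad Y=\delta\,\frac{x_v}{\sqrt G},\qquad l=X\times Y$$ (so $X=x_u/\sqrt E$, $Y=x_v/\sqrt G$ if $\varepsilon=\delta=1$); let $L,M,N$ be the coefficients of the second fundamental form with respect to $l$. The parameters are *principal* if $F=M=0$; then the principal curvatures and the principal geodesic curvatures are $$\nu_1=\frac LE,\qquad \nu_2=\frac NG,\qquad \gamma_1=-\delta\,\frac{E_v}{2E\sqrt G},\qquad \gamma_2=\varepsilon\,\frac{G_u}{2G\sqrt E}.$$ A surface in principal parameters is *strongly regular* if $(\nu_1-\nu_2)\gamma_1\gamma_2\ne0$ everywhere, and it is a *Weingarten surface* if $\nu_2=w(\nu_1)$ for a differentiable function $w$ on an interval. If $\nu_1=f(\nu)$ and $\nu_2=g(\nu)$ with $\nu=\nu(u,v)$, the principal parameters $(u,v)$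 are *geometric* if the functions $$\lambda=\ln\Big(\sqrt E\,\exp\int_{\nu_0}^{\nu}\frac{f'd\nu}{f-g}\Big),\qquad \mu=\ln\Big(\sqrt G\,\exp\int_{\nu_0}^{\nu}\frac{g'd\nu}{g-f}\Big)$$ are constant. **Theorem.** Let $2\le n\le\infty$. Let $f,g$ be functions of class $C^n$ on an open interval $\mathcal I\subseteq\mathbb R$ with $f-g>0$ and $f'g'\neq0$, let $\nu(u,v)$ be a function of class $C^n$ on an open set $\mathcal D\subseteq\mathbb R^2$ with values in $\mathcal I$ and with $\nu_u\nu_v\ne0$, let $(u_0,v_0)\in\mathcal D$, $\nu_0=\nu(u_0,v_0)$, and let $a\ne0$, $b\neq0$ be constants. Suppose that on $\mathcal D$ $$b^2\exp\Big(2\int_{\nu_0}^{\nu}\frac{g'd\nu}{g-f}\Big)\Big[f'\nu_{vv}+\Big(f''-\frac{2f'^2}{f-g}\Big)\nu_v^2\Big]-a^2\exp\Big(2\int_{\nu_0}^{\nu}\frac{f'd\nu}{f-g}\Big)\Big[g'\nu_{uu}+\Big(g''-\frac{2g'^2}{g-f}\Big)\nu_u^2\Big]=fg(f-g).$$ 1.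 (Existence) There are a connected open neighbourhood $\mathcal D_0\subseteq\mathcal D$ of $(u_0,v_0)$ and a strongly regular Weingarten surface $S:\ x=x(u,v)$, $(u,v)\in\mathcal D_0$, of class $C^n$, in principal parameters, which with respect to the orientation signs $\varepsilon=\operatorname{sign}a$, $\delta=\operatorname{sign}b$ has the invariants $$\nu_1=f(\nu),\qquad \nu_2=g(\nu),\qquad \gamma_1=\exp\Big(\int_{\nu_0}^{\nu}\frac{g'd\nu}{g-f}\Big)\frac{bf'}{f-g}\,\nu_v,\qquad \gamma_2=-\exp\Big(\int_{\nu_0}^{\nu}\frac{f'd\nu}{f-g}\Big)\frac{ag'}{g-f}\,\nu_u .$$ 2. (Uniqueness) Over any nonempty connected open set $\mathcal D_1\subseteq\mathcal D$, any two strongly regular Weingarten surfaces of class $C^2$ in principal parameters with these invariants (each with respect to some signs $\varepsilon,\delta\in\{1,-1\}$) differ by a motion, that is, by a rotation followed by a translation. 3. On every such surface over any nonempty connected open set $\mathcal D_1\subseteq\mathcal D$, the parameters $(u,v)$ are geometric principal parameters. -/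

import Mathlib

open Set

noncomputable section

namespace WeingartenSurface

/-- Euclidean three-space. -/
abbrev E3 : Type := EuclideanSpace ℝ (Fin 3)

/-- The partial derivative `h_u` of a function of `(u, v)`. -/
def du {V : Type*} [NormedAddCommGroup V] [NormedSpace ℝ V] (h : ℝ × ℝ → V) (p : ℝ × ℝ) : V :=
  fderiv ℝ h p (1, 0)

/-- The partial derivative `h_v` of a function of `(u, v)`. -/
def dv {V : Type*} [NormedAddCommGroup V] [NormedSpace ℝ V] (h : ℝ × ℝ → V) (p : ℝ × ℝ) : V :=
  fderiv ℝ h p (0, 1)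

/-- The vector product of Euclidean three-space. -/
def cross (y z : E3) : E3 := WithLp.toLp 2 (crossProduct y.ofLp z.ofLp)

/-! The coefficients `E, F, G` of the first fundamental form of `x = x(u, v)`. -/

def coeffE (x : ℝ × ℝ → E3) (p : ℝ × ℝ) : ℝ := inner ℝ (du x p) (du x p)

def coeffF (x : ℝ × ℝ → E3) (p : ℝ × ℝ) : ℝ := inner ℝ (du x p) (dv x p)

def coeffG (x : ℝ × ℝ → E3) (p : ℝ × ℝ) : ℝ := inner ℝ (dv x p) (dv x p)

/-! The moving frame `X, Y, l`. The numbers `ε, δ ∈ {1, -1}` record the orientation of the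
parametric lines: `X = ε x_u / √E`, `Y = δ x_v / √G`, and `l = X × Y`, so that the frame `X Y l` is
always right oriented. For `ε = δ = 1` one has `X = x_u / √E` and `Y = x_v / √G`. -/

def frameX (ε : ℝ) (x : ℝ × ℝ → E3) (p : ℝ × ℝ) : E3 := (ε / √(coeffE x p)) • du x p

def frameY (δ : ℝ) (x : ℝ × ℝ → E3) (p : ℝ × ℝ) : E3 := (δ / √(coeffG x p)) • dv x p

def normal (ε δ : ℝ) (x : ℝ × ℝ → E3) (p : ℝ × ℝ) : E3 := cross (frameX ε x p) (frameY δ x p)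

/-! The coefficients `L, M, N` of the second fundamental form with respect to the normal `l`. -/

def coeffL (ε δ : ℝ) (x : ℝ × ℝ → E3) (p : ℝ × ℝ) : ℝ :=
  inner ℝ (du (du x) p) (normal ε δ x p)

def coeffM (ε δ : ℝ) (x : ℝ × ℝ → E3) (p : ℝ × ℝ) : ℝ :=
  inner ℝ (dv (du x) p) (normal ε δ x p)

def coeffN (ε δ : ℝ) (x : ℝ × ℝ → E3) (p : ℝ × ℝ) : ℝ :=
  inner ℝ (dv (dv x) p) (normal ε δ x p)

/-! The principal curvatures `ν₁ = L / E`, `ν₂ = N / G` of a surface in principal parameters. -/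

def nu1 (ε δ : ℝ) (x : ℝ × ℝ → E3) (p : ℝ × ℝ) : ℝ := coeffL ε δ x p / coeffE x p

def nu2 (ε δ : ℝ) (x : ℝ × ℝ → E3) (p : ℝ × ℝ) : ℝ := coeffN ε δ x p / coeffG x p

/-! The principal geodesic curvatures `γ₁ = ⟨∇_X X, Y⟩ = - Y(E) / (2 E)` and
`γ₂ = ⟨∇_Y X, Y⟩ = X(G) / (2 G)`, where `X = (ε / √E) ∂_u` and `Y = (δ / √G) ∂_v`. -/

def gamma1 (δ : ℝ) (x : ℝ × ℝ → E3) (p : ℝ × ℝ) : ℝ :=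
  -(δ * dv (coeffE x) p / (2 * coeffE x p * √(coeffG x p)))

def gamma2 (ε : ℝ) (x : ℝ × ℝ → E3) (p : ℝ × ℝ) : ℝ :=
  ε * du (coeffG x) p / (2 * coeffG x p * √(coeffE x p))

/-- `x = x(u, v)`, `(u, v) ∈ D`, is a regular surface of class `C^k` whose parametric lines,
oriented by the signs `ε, δ`, are principal lines: `F = M = 0`. -/
structure IsPrincipal (k : ℕ∞) (ε δ : ℝ) (x : ℝ × ℝ → E3) (D : Set (ℝ × ℝ)) : Prop where
  sign_u : ε = 1 ∨ ε = -1
  sign_v : δ = 1 ∨ δ = -1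
  contDiffOn : ContDiffOn ℝ k x D
  regular : ∀ p ∈ D, LinearIndependent ℝ ![du x p, dv x p]
  coeffF_eq_zero : ∀ p ∈ D, coeffF x p = 0
  coeffM_eq_zero : ∀ p ∈ D, coeffM ε δ x p = 0

/-- A surface in principal parameters is strongly regular if `(ν₁ - ν₂) γ₁ γ₂ ≠ 0`. -/
def IsStronglyRegular (ε δ : ℝ) (x : ℝ × ℝ → E3) (D : Set (ℝ × ℝ)) : Prop :=
  ∀ p ∈ D, (nu1 ε δ x p - nu2 ε δ x p) * gamma1 δ x p * gamma2 ε x p ≠ 0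

/-- A surface is a Weingarten surface if `ν₂ = w(ν₁)` for a differentiable function `w` on an
interval. -/
def IsWeingarten (ε δ : ℝ) (x : ℝ × ℝ → E3) (D : Set (ℝ × ℝ)) : Prop :=
  ∃ (J : Set ℝ) (w : ℝ → ℝ), IsOpen J ∧ J.OrdConnected ∧ DifferentiableOn ℝ w J ∧
    ∀ p ∈ D, nu1 ε δ x p ∈ J ∧ nu2 ε δ x p = w (nu1 ε δ x p)

/-- A strongly regular Weingarten surface of class `C^k` in principal parameters. -/
structure IsStronglyRegularWeingarten (k : ℕ∞) (ε δ : ℝ) (x : ℝ × ℝ → E3) (D : Set (ℝ × ℝ)) :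
    Prop where
  isPrincipal : IsPrincipal k ε δ x D
  isStronglyRegular : IsStronglyRegular ε δ x D
  isWeingarten : IsWeingarten ε δ x D

/-- The surface has the given functions as its invariants `ν₁, ν₂, γ₁, γ₂` on `D`. -/
structure HasInvariants (ε δ : ℝ) (x : ℝ × ℝ → E3) (D : Set (ℝ × ℝ))
    (n₁ n₂ c₁ c₂ : ℝ × ℝ → ℝ) : Prop where
  nu1_eq : ∀ p ∈ D, nu1 ε δ x p = n₁ p
  nu2_eq : ∀ p ∈ D, nu2 ε δ x p = n₂ p
  gamma1_eq : ∀ p ∈ D, gamma1 δ x p = c₁ p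
  gamma2_eq : ∀ p ∈ D, gamma2 ε x p = c₂ p

/-- The factor `exp (∫_{t₀}^{t} h' / (h - k))`; both exponential factors of the theory are of this form,
namely `expInt f g` and `expInt g f`. -/
def expInt (h k : ℝ → ℝ) (t₀ t : ℝ) : ℝ :=
  Real.exp (∫ s in t₀..t, deriv h s / (h s - k s))

/-- The function `λ = ln (√E exp (∫ f' dν / (f - g)))`, the antiderivative being normalized to
vanish at `t₀`. -/
def lambdaFun (f g : ℝ → ℝ) (t₀ : ℝ) (ν : ℝ × ℝ → ℝ) (x : ℝ × ℝ → E3) (p : ℝ × ℝ) : ℝ :=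
  Real.log (√(coeffE x p) * expInt f g t₀ (ν p))

/-- The function `μ = ln (√G exp (∫ g' dν / (g - f)))`, the antiderivative being normalized to
vanish at `t₀`. -/
def muFun (f g : ℝ → ℝ) (t₀ : ℝ) (ν : ℝ × ℝ → ℝ) (x : ℝ × ℝ → E3) (p : ℝ × ℝ) : ℝ :=
  Real.log (√(coeffG x p) * expInt g f t₀ (ν p))

/-- The parameters `(u, v)` are geometric principal if the functions `λ` and `μ` are constant (this
does not depend on the choice of antiderivatives, that is, of `t₀`). -/
def IsGeometric (f g : ℝ → ℝ) (t₀ : ℝ) (ν : ℝ × ℝ → ℝ) (x : ℝ × ℝ → E3)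
    (D : Set (ℝ × ℝ)) : Prop :=
  (∃ c : ℝ, ∀ p ∈ D, lambdaFun f g t₀ ν x p = c) ∧ ∃ c : ℝ, ∀ p ∈ D, muFun f g t₀ ν x p = c

/-- Two surfaces over `D` differ by a motion (a rotation followed by a translation). -/
def DifferByMotion (x y : ℝ × ℝ → E3) (D : Set (ℝ × ℝ)) : Prop :=
  ∃ A ∈ Matrix.specialOrthogonalGroup (Fin 3) ℝ, ∃ c : E3,
    ∀ p ∈ D, y p = Matrix.toEuclideanLin A (x p) + c

/-- The second order equation for `ν` at the point `p`. -/
def GeometricPDE (f g : ℝ → ℝ) (a b t₀ : ℝ) (ν : ℝ × ℝ → ℝ) (p : ℝ × ℝ) : Prop :=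
  b ^ 2 * expInt g f t₀ (ν p) ^ 2 *
      (deriv f (ν p) * dv (dv ν) p +
        (deriv (deriv f) (ν p) - 2 * deriv f (ν p) ^ 2 / (f (ν p) - g (ν p))) * dv ν p ^ 2) -
    a ^ 2 * expInt f g t₀ (ν p) ^ 2 *
      (deriv g (ν p) * du (du ν) p +
        (deriv (deriv g) (ν p) - 2 * deriv g (ν p) ^ 2 / (g (ν p) - f (ν p))) * du ν p ^ 2) =
  f (ν p) * g (ν p) * (f (ν p) - g (ν p))

/-- The prescribed first principal geodesic curvature. -/
def presGamma1 (f g : ℝ → ℝ) (b t₀ : ℝ) (ν : ℝ × ℝ → ℝ) (p : ℝ × ℝ) : ℝ :=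
  expInt g f t₀ (ν p) * (b * deriv f (ν p) / (f (ν p) - g (ν p))) * dv ν p

/-- The prescribed second principal geodesic curvature. -/
def presGamma2 (f g : ℝ → ℝ) (a t₀ : ℝ) (ν : ℝ × ℝ → ℝ) (p : ℝ × ℝ) : ℝ :=
  -(expInt f g t₀ (ν p) * (a * deriv g (ν p) / (g (ν p) - f (ν p))) * du ν p)

/-- `x`, `(u, v) ∈ D`, is a strongly regular Weingarten surface of class `C^k` with principal
curvatures `f(ν)`, `g(ν)` and the prescribed principal geodesic curvatures, with respect to the
frame with orientation signs `ε, δ`. -/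
def IsSolution (k : ℕ∞) (f g : ℝ → ℝ) (a b t₀ : ℝ) (ν : ℝ × ℝ → ℝ) (ε δ : ℝ)
    (x : ℝ × ℝ → E3) (D : Set (ℝ × ℝ)) : Prop :=
  IsStronglyRegularWeingarten k ε δ x D ∧
    HasInvariants ε δ x D (fun p => f (ν p)) (fun p => g (ν p))
      (presGamma1 f g b t₀ ν) (presGamma2 f g a t₀ ν)

end WeingartenSurface

end

/-! The proof is Bonnet's theorem, with the metric read off from the invariants. Let P = `expInt f
g` and Q = `expInt g f`, evaluated along ν. The invariants force x_u = αX and x_v = βY with signed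
lengths α = 1/(aP) and β = 1/(bQ) (`scale`), and they force the connection components ⟨X_u, Y⟩ =
`connU` and ⟨X_v, Y⟩ = `connV`. The moving frame and the position vector then satisfy a linear first
order system whose coefficients depend only on f, g, a, b and ν.

Existence. The system is integrable exactly when α_v, β_u, (fα)_v and (gβ)_u have the right values
and the Gauss equation holds. The first four identities are automatic from the definition of P and
Q. The Gauss equation is the given second order equation for ν after clearing denominators
(`dv_connU_sub_du_connV`). A Frobenius theorem for linear systems with C¹ coefficients
(`exists_solution_of_compatible`) yields a frame and an immersion near the base point.
Orthonormality propagates because the connection matrix is antisymmetric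
(`IsFrameSystem.isRightFrame`), and a bootstrap on the frame equations gives class C^n.

Uniqueness. For a surface with these invariants, Rodrigues' formula and the symmetry of the mixed
derivatives of the normal give the Codazzi equations. Compared with the prescribed γ₁ and γ₂, and
since f'ν_v and g'ν_u do not vanish, these determine √G and √E together with the signs δ and ε
(`IsPrescription.sqrt_coeffG`, `IsPrescription.sqrt_coeffE`). Every solution is therefore adapted to
the same linear system (`IsPrescription.isAdapted`). Two orthonormal solutions differ by a constant
rotation, and the immersions then differ by a translation.

Geometric parameters. The identities √E · P = 1/|a| and √G · Q = 1/|b| are the constancy of λ and μ.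
-/

noncomputable section

namespace WeingartenSurface

open Metric Filter Topology

/-! ### Linear differential equations on short intervals -/

section LinearODE

variable {V : Type*} [NormedAddCommGroup V] [NormedSpace ℝ V]

/-- A priori bound on a symmetric interval that is short compared with the growth rate. -/
lemma norm_le_of_norm_deriv_le {z z' : ℝ → V} {t₀ ρ K η : ℝ} (hρ : 0 ≤ ρ) (hK : 0 ≤ K)
    (hη : 0 ≤ η) (hKρ : K * ρ ≤ 1 / 2)
    (hz : ∀ t ∈ Icc (t₀ - ρ) (t₀ + ρ), HasDerivWithinAt z (z' t) (Icc (t₀ - ρ) (t₀ + ρ)) t)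
    (hz' : ∀ t ∈ Icc (t₀ - ρ) (t₀ + ρ), ‖z' t‖ ≤ K * ‖z t‖ + η) :
    ∀ t ∈ Icc (t₀ - ρ) (t₀ + ρ), ‖z t‖ ≤ 2 * (‖z t₀‖ + ρ * η) := by
  have h0 : t₀ ∈ Icc (t₀ - ρ) (t₀ + ρ) := ⟨by linarith, by linarith⟩
  -- The mean value inequality is applied where ‖z‖ is largest. The term K ρ ‖z τ‖ is at most half
  -- of ‖z τ‖ and is absorbed on the left, so Gronwall's inequality is not needed.
  obtain ⟨τ, hτ, hmax⟩ := isCompact_Icc.exists_isMaxOn ⟨t₀, h0⟩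
    (HasDerivWithinAt.continuousOn hz).norm
  have hmax' : ∀ t ∈ Icc (t₀ - ρ) (t₀ + ρ), ‖z t‖ ≤ ‖z τ‖ := fun t ht => hmax ht
  have hmv := (convex_Icc (t₀ - ρ) (t₀ + ρ)).norm_image_sub_le_of_norm_hasDerivWithin_le
    (C := K * ‖z τ‖ + η) hz
    (fun t ht => (hz' t ht).trans (by have := hmax' t ht; gcongr)) h0 hτ
  have hd : ‖τ - t₀‖ ≤ ρ := by
    rw [Real.norm_eq_abs, abs_le]; constructor <;> linarith [hτ.1, hτ.2]
  have h1 : ‖z τ‖ ≤ ‖z t₀‖ + ‖z τ - z t₀‖ := by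
    simpa using norm_add_le (z t₀) (z τ - z t₀)
  have h2 : (K * ‖z τ‖ + η) * ‖τ - t₀‖ ≤ (K * ‖z τ‖ + η) * ρ := by gcongr
  have h3 : K * ρ * ‖z τ‖ ≤ 1 / 2 * ‖z τ‖ := by gcongr
  intro t ht
  linarith [hmax' t ht]

/-- Solutions of linear differential equations on short intervals. -/
lemma exists_linear_ode_solution [CompleteSpace V] {A : ℝ → V →L[ℝ] V} {t₀ ρ K : ℝ}
    (hρ : 0 ≤ ρ) (hK : 0 ≤ K) (hKρ : K * ρ ≤ 1 / 2)
    (hA : ContinuousOn A (Icc (t₀ - ρ) (t₀ + ρ)))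
    (hAK : ∀ t ∈ Icc (t₀ - ρ) (t₀ + ρ), ‖A t‖ ≤ K) (z₀ : V) :
    ∃ z : ℝ → V, z t₀ = z₀ ∧ ∀ t ∈ Icc (t₀ - ρ) (t₀ + ρ),
      HasDerivWithinAt z (A t (z t)) (Icc (t₀ - ρ) (t₀ + ρ)) t ∧ ‖z t‖ ≤ 2 * ‖z₀‖ := by
  have h0 : t₀ ∈ Icc (t₀ - ρ) (t₀ + ρ) := ⟨by linarith, by linarith⟩
  -- In the ball of radius ‖z₀‖ about z₀ the speed is at most 2K‖z₀‖. As Kρ ≤ 1/2, a solution cannot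
  -- leave the ball within time ρ, so one interval serves all initial values.
  have hP : IsPicardLindelof (fun t z => A t z) (⟨t₀, h0⟩ : Icc (t₀ - ρ) (t₀ + ρ)) z₀
      ‖z₀‖₊ 0 (K.toNNReal * (2 * ‖z₀‖₊)) K.toNNReal := by
    refine ⟨fun t ht => ?_, fun z _ => ?_, fun t ht z hz => ?_, ?_⟩
    · refine ((A t).lipschitz.weaken ?_).lipschitzOnWith
      rw [← norm_toNNReal]
      exact Real.toNNReal_le_toNNReal (hAK t ht)
    · exact hA.clm_apply continuousOn_const
    · have hz' : ‖z‖ ≤ 2 * ‖z₀‖ := by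
        have h1 : ‖z - z₀‖ ≤ ‖z₀‖ := by simpa [dist_eq_norm] using hz
        have h2 : ‖z‖ ≤ ‖z₀‖ + ‖z - z₀‖ := by simpa using norm_add_le z₀ (z - z₀)
        linarith
      refine ((A t).le_opNorm z).trans ?_
      push_cast
      rw [Real.coe_toNNReal K hK]
      have := hAK t ht
      gcongr
    · push_cast
      rw [Real.coe_toNNReal K hK]
      have : max (t₀ + ρ - t₀) (t₀ - (t₀ - ρ)) = ρ := by ring_nf; simp
      rw [this, sub_zero]
      nlinarith [norm_nonneg z₀]
  obtain ⟨z, hz0, hz⟩ := hP.exists_eq_forall_mem_Icc_hasDerivWithinAt₀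
  refine ⟨z, hz0, fun t ht => ⟨hz t ht, ?_⟩⟩
  have := norm_le_of_norm_deriv_le (η := 0) hρ hK le_rfl hKρ hz
    (fun t ht => by
      have h1 := (A t).le_opNorm (z t)
      have h2 := hAK t ht
      have h3 : ‖A t‖ * ‖z t‖ ≤ K * ‖z t‖ := by gcongr
      linarith) t ht
  rw [hz0] at this
  simpa using this

end LinearODE

/-! ### Partial derivatives and a uniform Taylor estimate -/

section Partial

variable {V : Type*} [NormedAddCommGroup V] [NormedSpace ℝ V] {h : ℝ × ℝ → V} {p : ℝ × ℝ}

lemma hasDerivAt_du (hh : DifferentiableAt ℝ h p) :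
    HasDerivAt (fun t => h (t, p.2)) (du h p) p.1 := by
  have := hh.hasFDerivAt.comp_hasDerivAt p.1 ((hasDerivAt_id p.1).prodMk (hasDerivAt_const p.1 p.2))
  exact this

lemma hasDerivAt_dv (hh : DifferentiableAt ℝ h p) :
    HasDerivAt (fun t => h (p.1, t)) (dv h p) p.2 := by
  have := hh.hasFDerivAt.comp_hasDerivAt p.2 ((hasDerivAt_const p.2 p.1).prodMk (hasDerivAt_id p.2))
  exact this

lemma fderiv_eq_of_du_dv (h : ℝ × ℝ → V) (p w : ℝ × ℝ) :
    fderiv ℝ h p w = w.1 • du h p + w.2 • dv h p := by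
  have : w = w.1 • ((1 : ℝ), (0 : ℝ)) + w.2 • ((0 : ℝ), (1 : ℝ)) := by ext <;> simp
  conv_lhs => rw [this]
  rw [map_add, map_smul, map_smul]
  rfl

lemma contDiffOn_du {U : Set (ℝ × ℝ)} (hU : IsOpen U) {m n : WithTop ℕ∞} (hmn : m + 1 ≤ n)
    (hh : ContDiffOn ℝ n h U) : ContDiffOn ℝ m (du h) U :=
  (hh.fderiv_of_isOpen hU hmn).clm_apply contDiffOn_const

lemma contDiffOn_dv {U : Set (ℝ × ℝ)} (hU : IsOpen U) {m n : WithTop ℕ∞} (hmn : m + 1 ≤ n)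
    (hh : ContDiffOn ℝ n h U) : ContDiffOn ℝ m (dv h) U :=
  (hh.fderiv_of_isOpen hU hmn).clm_apply contDiffOn_const

/-- First order expansion in the second variable, uniform on a compact rectangle. -/
lemma exists_uniform_expansion_snd {U : Set (ℝ × ℝ)} (hU : IsOpen U) (hh : ContDiffOn ℝ 1 h U)
    {I J : Set ℝ} (hI : IsCompact I) (hJ : IsCompact J) (hJc : Convex ℝ J) (hIJ : I ×ˢ J ⊆ U)
    {η : ℝ} (hη : 0 < η) :
    ∃ δ > 0, ∀ u ∈ I, ∀ v ∈ J, ∀ w ∈ J, |w - v| < δ →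
      ‖h (u, w) - h (u, v)‖ ≤ η ∧
      ‖h (u, w) - h (u, v) - (w - v) • dv h (u, v)‖ ≤ η * |w - v| := by
  have hcpt := hI.prod hJ
  have huc := hcpt.uniformContinuousOn_of_continuous (hh.continuousOn.mono hIJ)
  have hud := hcpt.uniformContinuousOn_of_continuous
    ((contDiffOn_dv (m := 0) hU (by simp) hh).continuousOn.mono hIJ)
  obtain ⟨δ₁, hδ₁, H₁⟩ := Metric.uniformContinuousOn_iff.1 huc η hη
  obtain ⟨δ₂, hδ₂, H₂⟩ := Metric.uniformContinuousOn_iff.1 hud η hη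
  refine ⟨min δ₁ δ₂, lt_min hδ₁ hδ₂, fun u hu v hv w hw hwv => ⟨?_, ?_⟩⟩
  · have := H₁ (u, w) ⟨hu, hw⟩ (u, v) ⟨hu, hv⟩ (by
      simpa [Prod.dist_eq, Real.dist_eq, hδ₁] using hwv.trans_le (min_le_left _ _))
    rw [dist_eq_norm] at this
    exact this.le
  · have hsub : uIcc v w ⊆ J := by
      rw [← segment_eq_uIcc]; exact hJc.segment_subset hv hw
    -- Subtracting the linear part turns the Taylor remainder into an increment whose derivative is
    -- bounded by uniform continuity of h_v.
    have hder : ∀ t ∈ uIcc v w, HasDerivWithinAt (fun t => h (u, t) - t • dv h (u, v))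
        (dv h (u, t) - dv h (u, v)) (uIcc v w) t := by
      intro t ht
      have hd : DifferentiableAt ℝ h (u, t) :=
        (hh.differentiableOn one_ne_zero).differentiableAt (hU.mem_nhds (hIJ ⟨hu, hsub ht⟩))
      have h2 := (hasDerivAt_id t).smul_const (dv h (u, v))
      rw [one_smul] at h2
      exact ((hasDerivAt_dv hd).sub h2).hasDerivWithinAt
    have := (convex_uIcc v w).norm_image_sub_le_of_norm_hasDerivWithin_le (C := η) hder
      (fun t ht => by
        have h3 : |t - v| ≤ |w - v| := abs_sub_left_of_mem_uIcc ht
        have := H₂ (u, t) ⟨hu, hsub ht⟩ (u, v) ⟨hu, hv⟩ (by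
          simpa [Prod.dist_eq, Real.dist_eq, hδ₂] using
            h3.trans_lt (hwv.trans_le (min_le_right _ _)))
        rw [dist_eq_norm] at this
        exact this.le) left_mem_uIcc right_mem_uIcc
    rw [Real.norm_eq_abs] at this
    convert this using 2
    rw [sub_smul]; abel

end Partial

/-! ### Frobenius theorem for linear systems in two variables -/

section Frobenius

variable {V : Type*} [NormedAddCommGroup V] [NormedSpace ℝ V]

/-- Propagation of the second equation of a compatible linear system along the first variable. -/
lemma hasDerivAt_snd_of_compatible {U : Set (ℝ × ℝ)} (hU : IsOpen U)
    {A B : ℝ × ℝ → V →L[ℝ] V} (hA : ContDiffOn ℝ 1 A U) (hB : ContDiffOn ℝ 1 B U)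
    (hAB : ∀ p ∈ U, dv A p + A p * B p = du B p + B p * A p)
    {u₀ v₀ ρ K M : ℝ} (hρ : 0 ≤ ρ) (hK : 0 ≤ K) (hM : 0 ≤ M) (hKρ : K * ρ ≤ 1 / 2)
    (hsub : Icc (u₀ - ρ) (u₀ + ρ) ×ˢ Icc (v₀ - ρ) (v₀ + ρ) ⊆ U)
    (hAK : ∀ u ∈ Icc (u₀ - ρ) (u₀ + ρ), ∀ v ∈ Icc (v₀ - ρ) (v₀ + ρ), ‖A (u, v)‖ ≤ K)
    (hBK : ∀ u ∈ Icc (u₀ - ρ) (u₀ + ρ), ∀ v ∈ Icc (v₀ - ρ) (v₀ + ρ), ‖B (u, v)‖ ≤ K)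
    {Z : ℝ × ℝ → V}
    (hZu : ∀ v ∈ Icc (v₀ - ρ) (v₀ + ρ), ∀ u ∈ Icc (u₀ - ρ) (u₀ + ρ),
      HasDerivWithinAt (fun t => Z (t, v)) (A (u, v) (Z (u, v))) (Icc (u₀ - ρ) (u₀ + ρ)) u)
    (hZM : ∀ v ∈ Icc (v₀ - ρ) (v₀ + ρ), ∀ u ∈ Icc (u₀ - ρ) (u₀ + ρ), ‖Z (u, v)‖ ≤ M)
    {v : ℝ} (hv : v ∈ Ioo (v₀ - ρ) (v₀ + ρ))
    (hZv : HasDerivAt (fun t => Z (u₀, t)) (B (u₀, v) (Z (u₀, v))) v)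
    {u : ℝ} (hu : u ∈ Icc (u₀ - ρ) (u₀ + ρ)) :
    HasDerivAt (fun t => Z (u, t)) (B (u, v) (Z (u, v))) v := by
  have hv' := Ioo_subset_Icc_self hv
  rw [hasDerivAt_iff_isLittleO, Asymptotics.isLittleO_iff]
  intro ε hε
  rw [hasDerivAt_iff_isLittleO, Asymptotics.isLittleO_iff] at hZv
  -- With η = ε / C, this C makes the a priori bound on the error below equal to ε |w - v|.
  set C : ℝ := 2 * (1 + ρ * (M + K * M)) with hC
  have hCpos : 0 < C := by positivity
  have hη : 0 < ε / C := by positivity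
  obtain ⟨δ, hδ, H⟩ := exists_uniform_expansion_snd hU hA isCompact_Icc isCompact_Icc
    (convex_Icc (v₀ - ρ) (v₀ + ρ)) hsub hη
  filter_upwards [hZv hη, Icc_mem_nhds hv.1 hv.2, Metric.ball_mem_nhds v hδ] with w hw hwI hwδ
  rw [mem_ball, Real.dist_eq] at hwδ
  set η : ℝ := ε / C
  -- The first order error in v, as a function of the first variable, solves the equation z' = A z
  -- up to a small forcing term. Differentiability of Z in v is thus obtained without a theorem on
  -- dependence on parameters.
  have hder : ∀ t ∈ Icc (u₀ - ρ) (u₀ + ρ), HasDerivWithinAt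
      (fun t => Z (t, w) - Z (t, v) - (w - v) • B (t, v) (Z (t, v)))
      (A (t, w) (Z (t, w)) - A (t, v) (Z (t, v)) -
        (w - v) • (du B (t, v) (Z (t, v)) + B (t, v) (A (t, v) (Z (t, v)))))
      (Icc (u₀ - ρ) (u₀ + ρ)) t := by
    intro t ht
    have hBd : DifferentiableAt ℝ B (t, v) :=
      (hB.differentiableOn one_ne_zero).differentiableAt (hU.mem_nhds (hsub ⟨ht, hv'⟩))
    exact ((hZu w hwI t ht).sub (hZu v hv' t ht)).sub
      (((hasDerivAt_du hBd).hasDerivWithinAt.clm_apply (hZu v hv' t ht)).const_smul (w - v))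
  have hbound := norm_le_of_norm_deriv_le (η := η * |w - v| * (M + K * M)) hρ hK
    (by positivity) hKρ hder (by
      intro t ht
      -- Compatibility trades B_u + BA for A_v + AB, after which only Taylor remainders of A are
      -- left in the forcing term.
      have hc : du B (t, v) (Z (t, v)) + B (t, v) (A (t, v) (Z (t, v))) =
          dv A (t, v) (Z (t, v)) + A (t, v) (B (t, v) (Z (t, v))) := by
        simpa using (congrArg (fun T : V →L[ℝ] V => T (Z (t, v)))
          (hAB (t, v) (hsub ⟨ht, hv'⟩))).symm
      have hsplit : A (t, w) (Z (t, w)) - A (t, v) (Z (t, v)) -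
          (w - v) • (du B (t, v) (Z (t, v)) + B (t, v) (A (t, v) (Z (t, v)))) =
          A (t, w) (Z (t, w) - Z (t, v) - (w - v) • B (t, v) (Z (t, v))) +
          ((A (t, w) - A (t, v) - (w - v) • dv A (t, v)) (Z (t, v)) +
          (w - v) • (A (t, w) - A (t, v)) (B (t, v) (Z (t, v)))) := by
        rw [hc]
        simp only [map_sub, map_smul, sub_apply, smul_apply, smul_add, smul_sub]
        abel
      rw [hsplit]
      obtain ⟨H1, H2⟩ := H t ht v hv' w hwI hwδ
      have hZ := hZM v hv' t ht
      have hBt := hBK t ht v hv'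
      refine (norm_add_le _ _).trans (add_le_add ?_ ?_)
      · refine (ContinuousLinearMap.le_opNorm _ _).trans ?_
        have := hAK t ht w hwI
        gcongr
      · refine (norm_add_le _ _).trans ?_
        have e1 : ‖(A (t, w) - A (t, v) - (w - v) • dv A (t, v)) (Z (t, v))‖ ≤
            η * |w - v| * M :=
          (ContinuousLinearMap.le_opNorm _ _).trans (by gcongr)
        have e3 : ‖B (t, v) (Z (t, v))‖ ≤ K * M :=
          (ContinuousLinearMap.le_opNorm _ _).trans (by gcongr)
        have e2 : ‖(w - v) • (A (t, w) - A (t, v)) (B (t, v) (Z (t, v)))‖ ≤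
            |w - v| * (η * (K * M)) := by
          rw [norm_smul, Real.norm_eq_abs]
          gcongr
          exact (ContinuousLinearMap.le_opNorm _ _).trans (by gcongr)
        linarith) u hu
  refine hbound.trans ?_
  rw [Real.norm_eq_abs] at hw ⊢
  have hεη : ε = C * η := by simp only [η]; field_simp
  calc 2 * (‖Z (u₀, w) - Z (u₀, v) - (w - v) • B (u₀, v) (Z (u₀, v))‖ +
        ρ * (η * |w - v| * (M + K * M)))
      ≤ 2 * (η * |w - v| + ρ * (η * |w - v| * (M + K * M))) := by gcongr
    _ = ε * |w - v| := by rw [hεη, hC]; ring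

/-- Local solvability of a compatible linear system `Z_u = A Z`, `Z_v = B Z`. -/
theorem exists_solution_of_compatible [CompleteSpace V] {U : Set (ℝ × ℝ)} (hU : IsOpen U)
    {A B : ℝ × ℝ → V →L[ℝ] V} (hA : ContDiffOn ℝ 1 A U) (hB : ContDiffOn ℝ 1 B U)
    (hAB : ∀ p ∈ U, dv A p + A p * B p = du B p + B p * A p)
    {p₀ : ℝ × ℝ} (hp₀ : p₀ ∈ U) (z₀ : V) :
    ∃ ρ > 0, ball p₀ ρ ⊆ U ∧ ∃ Z : ℝ × ℝ → V, Z p₀ = z₀ ∧ ∀ p ∈ ball p₀ ρ,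
      HasFDerivAt Z ((ContinuousLinearMap.toSpanSingleton ℝ (A p (Z p))).coprod
        (ContinuousLinearMap.toSpanSingleton ℝ (B p (Z p)))) p := by
  obtain ⟨u₀, v₀⟩ := p₀
  obtain ⟨R, hR, hRU⟩ := Metric.nhds_basis_closedBall.mem_iff.1 (hU.mem_nhds hp₀)
  have hcpt : IsCompact (closedBall (u₀, v₀) R) := isCompact_closedBall _ _
  obtain ⟨KA, hKA⟩ := hcpt.exists_bound_of_continuousOn (hA.continuousOn.mono hRU)
  obtain ⟨KB, hKB⟩ := hcpt.exists_bound_of_continuousOn (hB.continuousOn.mono hRU)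
  set K : ℝ := max (max KA KB) 1 with hKdef
  have hK1 : 1 ≤ K := le_max_right _ _
  have hKpos : 0 < K := by linarith
  set ρ : ℝ := min R (1 / (2 * K)) with hρdef
  have hρ : 0 < ρ := lt_min hR (by positivity)
  have hKρ : K * ρ ≤ 1 / 2 := by
    calc K * ρ ≤ K * (1 / (2 * K)) := by gcongr; exact min_le_right _ _
      _ = 1 / 2 := by field_simp
  have hbox : Icc (u₀ - ρ) (u₀ + ρ) ×ˢ Icc (v₀ - ρ) (v₀ + ρ) = closedBall (u₀, v₀) ρ := by
    rw [← closedBall_prod_same, Real.closedBall_eq_Icc, Real.closedBall_eq_Icc]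
  have hboxR : Icc (u₀ - ρ) (u₀ + ρ) ×ˢ Icc (v₀ - ρ) (v₀ + ρ) ⊆ closedBall (u₀, v₀) R := by
    rw [hbox]; exact closedBall_subset_closedBall (min_le_left _ _)
  have hsub := hboxR.trans hRU
  have hAK : ∀ u ∈ Icc (u₀ - ρ) (u₀ + ρ), ∀ v ∈ Icc (v₀ - ρ) (v₀ + ρ), ‖A (u, v)‖ ≤ K :=
    fun u hu v hv => (hKA _ (hboxR ⟨hu, hv⟩)).trans ((le_max_left _ _).trans (le_max_left _ _))
  have hBK : ∀ u ∈ Icc (u₀ - ρ) (u₀ + ρ), ∀ v ∈ Icc (v₀ - ρ) (v₀ + ρ), ‖B (u, v)‖ ≤ K :=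
    fun u hu v hv => (hKB _ (hboxR ⟨hu, hv⟩)).trans ((le_max_right _ _).trans (le_max_left _ _))
  have hu₀ : u₀ ∈ Icc (u₀ - ρ) (u₀ + ρ) := ⟨by linarith, by linarith⟩
  have hv₀ : v₀ ∈ Icc (v₀ - ρ) (v₀ + ρ) := ⟨by linarith, by linarith⟩
  -- The system is solved first along the line u = u₀ in the direction v, then from each point of
  -- that line in the direction u.
  obtain ⟨c, hc0, hc⟩ := exists_linear_ode_solution (A := fun t => B (u₀, t)) hρ.le hKpos.le hKρ
    (hB.continuousOn.comp (by fun_prop) fun t ht => hsub ⟨hu₀, ht⟩)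
    (fun t ht => hBK u₀ hu₀ t ht) z₀
  have hex : ∀ v : ℝ, ∃ z : ℝ → V, v ∈ Icc (v₀ - ρ) (v₀ + ρ) → z u₀ = c v ∧
      ∀ t ∈ Icc (u₀ - ρ) (u₀ + ρ),
        HasDerivWithinAt z (A (t, v) (z t)) (Icc (u₀ - ρ) (u₀ + ρ)) t ∧ ‖z t‖ ≤ 2 * ‖c v‖ := by
    intro v
    by_cases hv : v ∈ Icc (v₀ - ρ) (v₀ + ρ)
    · obtain ⟨z, hz⟩ := exists_linear_ode_solution (A := fun t => A (t, v)) hρ.le hKpos.le hKρ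
        (hA.continuousOn.comp (by fun_prop) fun t ht => hsub ⟨ht, hv⟩)
        (fun t ht => hAK t ht v hv) (c v)
      exact ⟨z, fun _ => hz⟩
    · exact ⟨0, fun h => absurd h hv⟩
  choose F hF using hex
  set Z : ℝ × ℝ → V := fun p => F p.2 p.1 with hZdef
  set M : ℝ := 2 * (2 * ‖z₀‖) with hM
  have hMpos : 0 ≤ M := by positivity
  have hZM : ∀ v ∈ Icc (v₀ - ρ) (v₀ + ρ), ∀ u ∈ Icc (u₀ - ρ) (u₀ + ρ), ‖Z (u, v)‖ ≤ M :=
    fun v hv u hu => (((hF v hv).2 u hu).2).trans (by linarith [(hc v hv).2])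
  have hZuW : ∀ v ∈ Icc (v₀ - ρ) (v₀ + ρ), ∀ u ∈ Icc (u₀ - ρ) (u₀ + ρ),
      HasDerivWithinAt (fun t => Z (t, v)) (A (u, v) (Z (u, v))) (Icc (u₀ - ρ) (u₀ + ρ)) u :=
    fun v hv u hu => ((hF v hv).2 u hu).1
  have hZv0 : ∀ v ∈ Ioo (v₀ - ρ) (v₀ + ρ),
      HasDerivAt (fun t => Z (u₀, t)) (B (u₀, v) (Z (u₀, v))) v := by
    intro v hv
    have h1 := (hc v (Ioo_subset_Icc_self hv)).1.hasDerivAt (Icc_mem_nhds hv.1 hv.2)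
    have h2 : (fun t => Z (u₀, t)) =ᶠ[𝓝 v] c := by
      filter_upwards [Icc_mem_nhds hv.1 hv.2] with t ht using (hF t ht).1
    rw [h2.eq_of_nhds]
    exact h1.congr_of_eventuallyEq h2
  have hball : ∀ p : ℝ × ℝ, p ∈ ball (u₀, v₀) ρ →
      p.1 ∈ Ioo (u₀ - ρ) (u₀ + ρ) ∧ p.2 ∈ Ioo (v₀ - ρ) (v₀ + ρ) := by
    intro p hp
    rwa [← ball_prod_same, Real.ball_eq_Ioo, Real.ball_eq_Ioo] at hp
  have hdu : ∀ p ∈ ball (u₀, v₀) ρ, HasDerivAt (fun t => Z (t, p.2)) (A p (Z p)) p.1 := by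
    intro p hp
    obtain ⟨h1, h2⟩ := hball p hp
    exact (hZuW p.2 (Ioo_subset_Icc_self h2) p.1 (Ioo_subset_Icc_self h1)).hasDerivAt
      (Icc_mem_nhds h1.1 h1.2)
  have hdv : ∀ p ∈ ball (u₀, v₀) ρ, HasDerivAt (fun t => Z (p.1, t)) (B p (Z p)) p.2 := by
    intro p hp
    obtain ⟨h1, h2⟩ := hball p hp
    exact hasDerivAt_snd_of_compatible hU hA hB hAB hρ.le hKpos.le hMpos hKρ hsub hAK hBK hZuW hZM
      h2 (hZv0 p.2 h2) (Ioo_subset_Icc_self h1)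
  -- Separate continuity is not enough; the bound ‖A Z‖ ≤ K M makes Z Lipschitz in u uniformly in v,
  -- which gives joint continuity.
  have hcont : ContinuousOn Z (ball (u₀, v₀) ρ) := by
    rw [← ball_prod_same, Real.ball_eq_Ioo, Real.ball_eq_Ioo]
    refine continuousOn_prod_of_continuousOn_lipschitzOnWith Z (K * M).toNNReal ?_ ?_
    · intro u hu v hv
      refine ((hdv (u, v) ?_).continuousAt).continuousWithinAt
      rw [← ball_prod_same, Real.ball_eq_Ioo, Real.ball_eq_Ioo]
      exact ⟨hu, hv⟩
    · intro v hv
      refine LipschitzOnWith.mono ?_ (Ioo_subset_Icc_self (a := u₀ - ρ) (b := u₀ + ρ))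
      refine (convex_Icc _ _).lipschitzOnWith_of_nnnorm_hasDerivWithin_le
        (hZuW v (Ioo_subset_Icc_self hv)) fun t ht => ?_
      rw [← norm_toNNReal]
      refine Real.toNNReal_le_toNNReal ((ContinuousLinearMap.le_opNorm _ _).trans ?_)
      have h1 := hAK t ht v (Ioo_subset_Icc_self hv)
      have h2 := hZM v (Ioo_subset_Icc_self hv) t ht
      gcongr
  refine ⟨ρ, hρ, ball_subset_closedBall.trans (hbox ▸ hsub), Z, ?_, fun p hp => ?_⟩
  · exact ((hF v₀ hv₀).1).trans hc0
  · have hnear := isOpen_ball.mem_nhds hp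
    have hpU : p ∈ U := hsub (hbox ▸ ball_subset_closedBall hp)
    have cA : ContinuousAt A p := hA.continuousOn.continuousAt (hU.mem_nhds hpU)
    have cB : ContinuousAt B p := hB.continuousOn.continuousAt (hU.mem_nhds hpU)
    have cZ : ContinuousAt Z p := hcont.continuousAt hnear
    have cS : Continuous fun z : V => ContinuousLinearMap.toSpanSingleton ℝ z :=
      (ContinuousLinearMap.toSpanSingletonCLE (𝕜 := ℝ) (E := V)).continuous
    -- The partial derivatives A Z and B Z are now known to be continuous, so Z is totally
    -- differentiable.
    have := hasStrictFDerivAt_uncurry_coprod (𝕜 := ℝ) (u := p) (f := fun x y => Z (x, y))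
      (f₁ := fun x y => ContinuousLinearMap.toSpanSingleton ℝ (A (x, y) (Z (x, y))))
      (f₂ := fun x y => ContinuousLinearMap.toSpanSingleton ℝ (B (x, y) (Z (x, y))))
      (by filter_upwards [hnear] with q hq using (hdu q hq).hasFDerivAt)
      (by filter_upwards [hnear] with q hq using (hdv q hq).hasFDerivAt)
      (cS.continuousAt.comp (cA.clm_apply cZ)) (cS.continuousAt.comp (cB.clm_apply cZ))
    exact this.hasFDerivAt

end Frobenius

/-! ### Calculus rules for the partial derivatives -/

section PartialCalculus

variable {V : Type*} [NormedAddCommGroup V] [NormedSpace ℝ V] {p : ℝ × ℝ}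

lemma du_congr {h k : ℝ × ℝ → V} (e : h =ᶠ[𝓝 p] k) : du h p = du k p := by
  simp only [du, e.fderiv_eq]

lemma dv_congr {h k : ℝ × ℝ → V} (e : h =ᶠ[𝓝 p] k) : dv h p = dv k p := by
  simp only [dv, e.fderiv_eq]

lemma du_congr_on {h k : ℝ × ℝ → V} {D : Set (ℝ × ℝ)} (hD : IsOpen D) (e : ∀ q ∈ D, h q = k q)
    (hp : p ∈ D) : du h p = du k p :=
  du_congr (by filter_upwards [hD.mem_nhds hp] with q hq using e q hq)

lemma dv_congr_on {h k : ℝ × ℝ → V} {D : Set (ℝ × ℝ)} (hD : IsOpen D) (e : ∀ q ∈ D, h q = k q)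
    (hp : p ∈ D) : dv h p = dv k p :=
  dv_congr (by filter_upwards [hD.mem_nhds hp] with q hq using e q hq)

lemma du_const (c : V) : du (fun _ => c) p = 0 := by simp [du]

lemma dv_const (c : V) : dv (fun _ => c) p = 0 := by simp [dv]

lemma du_neg (h : ℝ × ℝ → V) : du (fun q => -h q) p = -du h p := by simp [du]

lemma dv_neg (h : ℝ × ℝ → V) : dv (fun q => -h q) p = -dv h p := by simp [dv]

lemma du_sub {h k : ℝ × ℝ → V} (hh : DifferentiableAt ℝ h p) (hk : DifferentiableAt ℝ k p) :
    du (fun q => h q - k q) p = du h p - du k p := by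
  simp [du, fderiv_fun_sub hh hk]

lemma dv_sub {h k : ℝ × ℝ → V} (hh : DifferentiableAt ℝ h p) (hk : DifferentiableAt ℝ k p) :
    dv (fun q => h q - k q) p = dv h p - dv k p := by
  simp [dv, fderiv_fun_sub hh hk]

lemma du_smul {c : ℝ × ℝ → ℝ} {h : ℝ × ℝ → V} (hc : DifferentiableAt ℝ c p)
    (hh : DifferentiableAt ℝ h p) :
    du (fun q => c q • h q) p = c p • du h p + du c p • h p := by
  simp [du, fderiv_fun_smul hc hh]

lemma dv_smul {c : ℝ × ℝ → ℝ} {h : ℝ × ℝ → V} (hc : DifferentiableAt ℝ c p)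
    (hh : DifferentiableAt ℝ h p) :
    dv (fun q => c q • h q) p = c p • dv h p + dv c p • h p := by
  simp [dv, fderiv_fun_smul hc hh]

lemma du_mul {c h : ℝ × ℝ → ℝ} (hc : DifferentiableAt ℝ c p) (hh : DifferentiableAt ℝ h p) :
    du (fun q => c q * h q) p = c p * du h p + du c p * h p := du_smul hc hh

lemma dv_mul {c h : ℝ × ℝ → ℝ} (hc : DifferentiableAt ℝ c p) (hh : DifferentiableAt ℝ h p) :
    dv (fun q => c q * h q) p = c p * dv h p + dv c p * h p := dv_smul hc hh

lemma du_inner {h k : ℝ × ℝ → E3} (hh : DifferentiableAt ℝ h p) (hk : DifferentiableAt ℝ k p) :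
    du (fun q => (inner ℝ (h q) (k q) : ℝ)) p = inner ℝ (h p) (du k p) + inner ℝ (du h p) (k p) := by
  simp [du, fderiv_inner_apply ℝ hh hk]

lemma dv_inner {h k : ℝ × ℝ → E3} (hh : DifferentiableAt ℝ h p) (hk : DifferentiableAt ℝ k p) :
    dv (fun q => (inner ℝ (h q) (k q) : ℝ)) p = inner ℝ (h p) (dv k p) + inner ℝ (dv h p) (k p) := by
  simp [dv, fderiv_inner_apply ℝ hh hk]

lemma du_comp {φ : ℝ → ℝ} {φ' : ℝ} {h : ℝ × ℝ → ℝ} (hφ : HasDerivAt φ φ' (h p))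
    (hh : DifferentiableAt ℝ h p) : du (fun q => φ (h q)) p = φ' * du h p := by
  have : HasFDerivAt (fun q => φ (h q)) (φ' • fderiv ℝ h p) p :=
    hφ.comp_hasFDerivAt p hh.hasFDerivAt
  simp [du, this.fderiv]

lemma dv_comp {φ : ℝ → ℝ} {φ' : ℝ} {h : ℝ × ℝ → ℝ} (hφ : HasDerivAt φ φ' (h p))
    (hh : DifferentiableAt ℝ h p) : dv (fun q => φ (h q)) p = φ' * dv h p := by
  have : HasFDerivAt (fun q => φ (h q)) (φ' • fderiv ℝ h p) p :=
    hφ.comp_hasFDerivAt p hh.hasFDerivAt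
  simp [dv, this.fderiv]

lemma du_clm_comp {W : Type*} [NormedAddCommGroup W] [NormedSpace ℝ W] (T : V →L[ℝ] W)
    {h : ℝ × ℝ → V} (hh : DifferentiableAt ℝ h p) : du (fun q => T (h q)) p = T (du h p) := by
  have := (T.hasFDerivAt.comp p hh.hasFDerivAt).fderiv
  exact congrArg (fun S => S (1, 0)) this

lemma dv_clm_comp {W : Type*} [NormedAddCommGroup W] [NormedSpace ℝ W] (T : V →L[ℝ] W)
    {h : ℝ × ℝ → V} (hh : DifferentiableAt ℝ h p) : dv (fun q => T (h q)) p = T (dv h p) := by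
  have := (T.hasFDerivAt.comp p hh.hasFDerivAt).fderiv
  exact congrArg (fun S => S (0, 1)) this

lemma hasFDerivAt_coord {h : ℝ × ℝ → E3} (hh : DifferentiableAt ℝ h p) (i : Fin 3) :
    HasFDerivAt (fun q => h q i) ((EuclideanSpace.proj i : E3 →L[ℝ] ℝ).comp (fderiv ℝ h p)) p :=
  (EuclideanSpace.proj i : E3 →L[ℝ] ℝ).hasFDerivAt.comp p hh.hasFDerivAt

lemma du_apply {ι : Type*} [Fintype ι] {h : ℝ × ℝ → ι → V} (hh : DifferentiableAt ℝ h p) (i : ι) :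
    du (fun q => h q i) p = du h p i :=
  du_clm_comp (ContinuousLinearMap.proj i : (ι → V) →L[ℝ] V) hh

lemma dv_apply {ι : Type*} [Fintype ι] {h : ℝ × ℝ → ι → V} (hh : DifferentiableAt ℝ h p) (i : ι) :
    dv (fun q => h q i) p = dv h p i :=
  dv_clm_comp (ContinuousLinearMap.proj i : (ι → V) →L[ℝ] V) hh

lemma exists_const_of_du_dv_eq_zero {D : Set (ℝ × ℝ)} (hD : IsOpen D) (hc : IsPreconnected D)
    {h : ℝ × ℝ → V} (hh : DifferentiableOn ℝ h D) (hu : ∀ p ∈ D, du h p = 0)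
    (hv : ∀ p ∈ D, dv h p = 0) : ∃ c, ∀ p ∈ D, h p = c := by
  refine hD.exists_is_const_of_fderiv_eq_zero hc hh fun p hp => ?_
  ext <;> simp [fderiv_eq_of_du_dv h p, hu p hp, hv p hp]

end PartialCalculus

/-! ### Frame equations and their first integrals -/

/-- The derivative equations of an orthonormal frame along principal parameter lines. -/
structure IsFrameSystem (r s κ τ : ℝ × ℝ → ℝ) (X Y N : ℝ × ℝ → E3) (D : Set (ℝ × ℝ)) : Prop where
  diffX : ∀ p ∈ D, DifferentiableAt ℝ X p
  diffY : ∀ p ∈ D, DifferentiableAt ℝ Y p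
  diffN : ∀ p ∈ D, DifferentiableAt ℝ N p
  du_X : ∀ p ∈ D, du X p = r p • Y p + κ p • N p
  du_Y : ∀ p ∈ D, du Y p = -(r p • X p)
  du_N : ∀ p ∈ D, du N p = -(κ p • X p)
  dv_X : ∀ p ∈ D, dv X p = s p • Y p
  dv_Y : ∀ p ∈ D, dv Y p = -(s p • X p) + τ p • N p
  dv_N : ∀ p ∈ D, dv N p = -(τ p • Y p)

namespace IsFrameSystem

variable {r s κ τ : ℝ × ℝ → ℝ} {X Y N X' Y' N' : ℝ × ℝ → E3} {D : Set (ℝ × ℝ)}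

/-- Two frames with the same derivative equations differ by a constant linear map. -/
lemma exists_const (hD : IsOpen D) (hc : IsPreconnected D) (h : IsFrameSystem r s κ τ X Y N D)
    (h' : IsFrameSystem r s κ τ X' Y' N' D) (i j : Fin 3) :
    ∃ c, ∀ p ∈ D, X' p i * X p j + Y' p i * Y p j + N' p i * N p j = c := by
  have hd : ∀ p ∈ D, HasFDerivAt (fun p => X' p i * X p j + Y' p i * Y p j + N' p i * N p j)
      _ p := fun p hp =>
    ((((hasFDerivAt_coord (h'.diffX p hp) i).mul
      (hasFDerivAt_coord (h.diffX p hp) j)).add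
    ((hasFDerivAt_coord (h'.diffY p hp) i).mul
      (hasFDerivAt_coord (h.diffY p hp) j))).add
    ((hasFDerivAt_coord (h'.diffN p hp) i).mul
      (hasFDerivAt_coord (h.diffN p hp) j)))
  -- The sum is an entry of the product F'ᵀF of frame matrices. Both frames satisfy dF = ΩF with the
  -- same antisymmetric Ω, so d(F'ᵀF) = F'ᵀ(Ωᵀ + Ω)F = 0.
  refine exists_const_of_du_dv_eq_zero hD hc
    (fun p hp => (hd p hp).differentiableAt.differentiableWithinAt) (fun p hp => ?_) fun p hp => ?_
  · have e1 := h.du_X p hp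
    have e2 := h.du_Y p hp
    have e3 := h.du_N p hp
    have e1' := h'.du_X p hp
    have e2' := h'.du_Y p hp
    have e3' := h'.du_N p hp
    unfold du at e1 e2 e3 e1' e2' e3' ⊢
    rw [(hd p hp).fderiv]
    simp [e1, e2, e3, e1', e2', e3']
    ring
  · have e1 := h.dv_X p hp
    have e2 := h.dv_Y p hp
    have e3 := h.dv_N p hp
    have e1' := h'.dv_X p hp
    have e2' := h'.dv_Y p hp
    have e3' := h'.dv_N p hp
    unfold dv at e1 e2 e3 e1' e2' e3' ⊢
    rw [(hd p hp).fderiv]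
    simp [e1, e2, e3, e1', e2', e3']
    ring

/-- The determinant of a frame is constant. -/
lemma exists_const_det (hD : IsOpen D) (hc : IsPreconnected D)
    (h : IsFrameSystem r s κ τ X Y N D) :
    ∃ c, ∀ p ∈ D, X p 0 * (Y p 1 * N p 2 - Y p 2 * N p 1) + X p 1 * (Y p 2 * N p 0 - Y p 0 * N p 2)
      + X p 2 * (Y p 0 * N p 1 - Y p 1 * N p 0) = c := by
  have hX := fun p hp i => hasFDerivAt_coord (h.diffX p hp) i
  have hY := fun p hp i => hasFDerivAt_coord (h.diffY p hp) i
  have hN := fun p hp i => hasFDerivAt_coord (h.diffN p hp) i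
  have hd : ∀ p ∈ D, HasFDerivAt (fun p => X p 0 * (Y p 1 * N p 2 - Y p 2 * N p 1) +
      X p 1 * (Y p 2 * N p 0 - Y p 0 * N p 2) + X p 2 * (Y p 0 * N p 1 - Y p 1 * N p 0))
      _ p := fun p hp =>
    (((hX p hp 0).mul (((hY p hp 1).mul (hN p hp 2)).sub ((hY p hp 2).mul (hN p hp 1)))).add
    ((hX p hp 1).mul (((hY p hp 2).mul (hN p hp 0)).sub ((hY p hp 0).mul (hN p hp 2))))).add
    ((hX p hp 2).mul (((hY p hp 0).mul (hN p hp 1)).sub ((hY p hp 1).mul (hN p hp 0))))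
  -- The logarithmic derivative of the determinant is the trace of an antisymmetric matrix.
  refine exists_const_of_du_dv_eq_zero hD hc
    (fun p hp => (hd p hp).differentiableAt.differentiableWithinAt) (fun p hp => ?_) fun p hp => ?_
  · have e1 := h.du_X p hp
    have e2 := h.du_Y p hp
    have e3 := h.du_N p hp
    unfold du at e1 e2 e3 ⊢
    rw [(hd p hp).fderiv]
    simp [e1, e2, e3]
    ring
  · have e1 := h.dv_X p hp
    have e2 := h.dv_Y p hp
    have e3 := h.dv_N p hp
    unfold dv at e1 e2 e3 ⊢
    rw [(hd p hp).fderiv]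
    simp [e1, e2, e3]
    ring

end IsFrameSystem

/-! ### Integration of the frame equations -/

section Existence

/-- The action of square matrices on families of vectors. -/
def matAct : (Fin 4 → Fin 4 → ℝ) →L[ℝ] ((Fin 4 → E3) →L[ℝ] (Fin 4 → E3)) :=
  LinearMap.toContinuousLinearMap
    { toFun := fun m => ContinuousLinearMap.pi fun i =>
        ∑ j, m i j • (ContinuousLinearMap.proj j : (Fin 4 → E3) →L[ℝ] E3)
      map_add' := fun m m' => by
        ext z i k
        simp [add_mul, Finset.sum_add_distrib]
      map_smul' := fun c m => by
        ext z i k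
        simp [Finset.mul_sum, mul_assoc] }

lemma matAct_apply (m : Fin 4 → Fin 4 → ℝ) (z : Fin 4 → E3) (i : Fin 4) :
    matAct m z i = ∑ j, m i j • z j := by
  simp [matAct]

/-- Local existence of a frame together with the immersion it is adapted to. -/
theorem exists_frameSystem {D : Set (ℝ × ℝ)} (hD : IsOpen D) {α β r s κ τ : ℝ × ℝ → ℝ}
    (hα : ContDiffOn ℝ 1 α D) (hβ : ContDiffOn ℝ 1 β D) (hr : ContDiffOn ℝ 1 r D)
    (hs : ContDiffOn ℝ 1 s D) (hκ : ContDiffOn ℝ 1 κ D) (hτ : ContDiffOn ℝ 1 τ D)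
    (hαv : ∀ p ∈ D, dv α p = -(β p * r p)) (hβu : ∀ p ∈ D, du β p = α p * s p)
    (hκv : ∀ p ∈ D, dv κ p = -(τ p * r p)) (hτu : ∀ p ∈ D, du τ p = κ p * s p)
    (hrs : ∀ p ∈ D, dv r p - du s p = κ p * τ p) {p₀ : ℝ × ℝ} (hp₀ : p₀ ∈ D) :
    ∃ ρ > 0, ball p₀ ρ ⊆ D ∧ ∃ x X Y N : ℝ × ℝ → E3,
      (∀ p ∈ ball p₀ ρ, DifferentiableAt ℝ x p ∧ du x p = α p • X p ∧ dv x p = β p • Y p) ∧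
      IsFrameSystem r s κ τ X Y N (ball p₀ ρ) ∧ X p₀ = EuclideanSpace.single 0 1 ∧
      Y p₀ = EuclideanSpace.single 1 1 ∧ N p₀ = EuclideanSpace.single 2 1 := by
  -- Rows and columns are indexed by x, X, Y, N. Including the position vector in the unknown makes
  -- a second integration for x unnecessary.
  set a : ℝ × ℝ → Fin 4 → Fin 4 → ℝ := fun p =>
    ![![0, α p, 0, 0], ![0, 0, r p, κ p], ![0, -r p, 0, 0], ![0, -κ p, 0, 0]] with ha
  set b : ℝ × ℝ → Fin 4 → Fin 4 → ℝ := fun p =>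
    ![![0, 0, β p, 0], ![0, 0, s p, 0], ![0, -s p, 0, τ p], ![0, 0, -τ p, 0]] with hb
  have hac : ContDiffOn ℝ 1 a D := by
    rw [contDiffOn_pi]; intro i
    rw [contDiffOn_pi]; intro j
    fin_cases i <;> fin_cases j <;>
      simp [ha, contDiffOn_const, hα, hr, hκ, hr.neg, hκ.neg]
  have hbc : ContDiffOn ℝ 1 b D := by
    rw [contDiffOn_pi]; intro i
    rw [contDiffOn_pi]; intro j
    fin_cases i <;> fin_cases j <;>
      simp [hb, contDiffOn_const, hβ, hs, hτ, hs.neg, hτ.neg]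
  have hcompat : ∀ p ∈ D, dv (fun p => matAct (a p)) p + matAct (a p) * matAct (b p) =
      du (fun p => matAct (b p)) p + matAct (b p) * matAct (a p) := by
    intro p hp
    have hnear := hD.mem_nhds hp
    have had : DifferentiableAt ℝ a p := (hac.differentiableOn one_ne_zero).differentiableAt hnear
    have hbd : DifferentiableAt ℝ b p := (hbc.differentiableOn one_ne_zero).differentiableAt hnear
    have hdva : ∀ i j, dv a p i j = dv (fun q => a q i j) p := by
      intro i j
      rw [← dv_apply had i, ← dv_apply (differentiableAt_pi.1 had i) j]
    have hdub : ∀ i j, du b p i j = du (fun q => b q i j) p := by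
      intro i j
      rw [← du_apply hbd i, ← du_apply (differentiableAt_pi.1 hbd i) j]
    rw [dv_clm_comp matAct had, du_clm_comp matAct hbd]
    refine ContinuousLinearMap.ext fun z => ?_
    ext i k
    have h1 := hαv p hp
    have h2 := hβu p hp
    have h3 := hκv p hp
    have h4 := hτu p hp
    have h5 := hrs p hp
    simp only [add_apply, mul_apply_eq_comp, Pi.add_apply, matAct_apply, hdva, hdub]
    -- Row x uses the two equations for α and β, which express x_uv = x_vu. Rows X and Y use one
    -- Codazzi equation each together with the Gauss equation, and row N uses both Codazzi
    -- equations.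
    fin_cases i
    · simp [Fin.sum_univ_four, ha, hb, dv_const, du_const, h1, h2]
      ring
    · simp [Fin.sum_univ_four, ha, hb, dv_const, du_const, h3]
      linear_combination z 2 k * h5
    · simp [Fin.sum_univ_four, ha, hb, dv_const, du_const, dv_neg, du_neg, h4]
      linear_combination -z 1 k * h5
    · simp [Fin.sum_univ_four, ha, hb, dv_const, du_const, dv_neg, du_neg, h3, h4]
      ring
  obtain ⟨ρ, hρ, hball, Z, hZ0, hZ⟩ := exists_solution_of_compatible hD
    (A := fun p => matAct (a p)) (B := fun p => matAct (b p))
    (matAct.contDiff.comp_contDiffOn hac) (matAct.contDiff.comp_contDiffOn hbc) hcompat hp₀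
    ![0, EuclideanSpace.single 0 1, EuclideanSpace.single 1 1, EuclideanSpace.single 2 1]
  have hdu : ∀ p ∈ ball p₀ ρ, ∀ i, du (fun q => Z q i) p = ∑ j, a p i j • Z p j := by
    intro p hp i
    rw [du_apply (hZ p hp).differentiableAt i, du, (hZ p hp).fderiv]
    simp [matAct_apply]
  have hdv : ∀ p ∈ ball p₀ ρ, ∀ i, dv (fun q => Z q i) p = ∑ j, b p i j • Z p j := by
    intro p hp i
    rw [dv_apply (hZ p hp).differentiableAt i, dv, (hZ p hp).fderiv]
    simp [matAct_apply]
  have hd : ∀ p ∈ ball p₀ ρ, ∀ i, DifferentiableAt ℝ (fun q => Z q i) p :=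
    fun p hp i => differentiableAt_pi.1 (hZ p hp).differentiableAt i
  refine ⟨ρ, hρ, hball, fun q => Z q 0, fun q => Z q 1, fun q => Z q 2, fun q => Z q 3,
    fun p hp => ⟨hd p hp 0, ?_, ?_⟩, ⟨fun p hp => hd p hp 1, fun p hp => hd p hp 2,
    fun p hp => hd p hp 3, fun p hp => ?_, fun p hp => ?_, fun p hp => ?_, fun p hp => ?_,
    fun p hp => ?_, fun p hp => ?_⟩, ?_, ?_, ?_⟩
  all_goals first
    | (rw [hdu p hp]; simp [Fin.sum_univ_four, ha])
    | (rw [hdv p hp]; simp [Fin.sum_univ_four, hb])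
    | simp [hZ0]

end Existence

/-! ### Right oriented orthonormal frames and rotations -/

section Frames

lemma inner_eq_coords (y z : E3) : (inner ℝ y z : ℝ) = y 0 * z 0 + y 1 * z 1 + y 2 * z 2 := by
  simp [PiLp.inner_apply, Fin.sum_univ_three, mul_comm]

lemma cross_apply_zero (y z : E3) : cross y z 0 = y 1 * z 2 - y 2 * z 1 := by
  simp [cross, crossProduct]

lemma cross_apply_one (y z : E3) : cross y z 1 = y 2 * z 0 - y 0 * z 2 := by
  simp [cross, crossProduct]

lemma cross_apply_two (y z : E3) : cross y z 2 = y 0 * z 1 - y 1 * z 0 := by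
  simp [cross, crossProduct]

/-- `X, Y, N` is a right oriented orthonormal frame. -/
structure IsRightFrame (X Y N : E3) : Prop where
  inner_XX : (inner ℝ X X : ℝ) = 1
  inner_YY : (inner ℝ Y Y : ℝ) = 1
  inner_XY : (inner ℝ X Y : ℝ) = 0
  eq_cross : N = cross X Y

/-- The matrix with rows `X, Y, N`. -/
def frameMatrix (X Y N : E3) : Matrix (Fin 3) (Fin 3) ℝ := Matrix.of ![X.ofLp, Y.ofLp, N.ofLp]

lemma frameMatrix_det (X Y N : E3) : (frameMatrix X Y N).det =
    X 0 * (Y 1 * N 2 - Y 2 * N 1) + X 1 * (Y 2 * N 0 - Y 0 * N 2)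
      + X 2 * (Y 0 * N 1 - Y 1 * N 0) := by
  rw [Matrix.det_fin_three]
  simp [frameMatrix]
  ring

lemma frameMatrix_transpose_mul_apply (X Y N X' Y' N' : E3) (i j : Fin 3) :
    ((frameMatrix X' Y' N').transpose * frameMatrix X Y N) i j =
      X' i * X j + Y' i * Y j + N' i * N j := by
  simp [Matrix.mul_apply, Fin.sum_univ_three, frameMatrix]

lemma frameMatrix_mul_transpose (X Y N : E3) :
    frameMatrix X Y N * (frameMatrix X Y N).transpose =
      !![inner ℝ X X, inner ℝ X Y, inner ℝ X N; inner ℝ Y X, inner ℝ Y Y, inner ℝ Y N;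
        inner ℝ N X, inner ℝ N Y, inner ℝ N N] := by
  ext i j
  fin_cases i <;> fin_cases j <;>
    simp [Matrix.mul_apply, Fin.sum_univ_three, frameMatrix, ← inner_eq_coords]

lemma one_apply_sum (v : Fin 3 → ℝ) (i : Fin 3) :
    (1 : Matrix (Fin 3) (Fin 3) ℝ) i 0 * v 0 + (1 : Matrix (Fin 3) (Fin 3) ℝ) i 1 * v 1 +
      (1 : Matrix (Fin 3) (Fin 3) ℝ) i 2 * v 2 = v i := by
  have := congrFun (Matrix.one_mulVec v) i
  rwa [Matrix.mulVec, dotProduct, Fin.sum_univ_three] at this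

namespace IsRightFrame

variable {X Y N X' Y' N' : E3}

lemma inner_NX (h : IsRightFrame X Y N) : (inner ℝ N X : ℝ) = 0 := by
  rw [h.eq_cross, inner_eq_coords, cross_apply_zero, cross_apply_one, cross_apply_two]; ring

lemma inner_NY (h : IsRightFrame X Y N) : (inner ℝ N Y : ℝ) = 0 := by
  rw [h.eq_cross, inner_eq_coords, cross_apply_zero, cross_apply_one, cross_apply_two]; ring

lemma inner_NN (h : IsRightFrame X Y N) : (inner ℝ N N : ℝ) = 1 := by
  have h1 := h.inner_XX
  have h2 := h.inner_YY
  have h3 := h.inner_XY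
  rw [inner_eq_coords] at h1 h2 h3
  rw [h.eq_cross, inner_eq_coords, cross_apply_zero, cross_apply_one, cross_apply_two]
  -- Lagrange's identity |X × Y|² = |X|²|Y|² - ⟨X, Y⟩².
  linear_combination (Y 0 * Y 0 + Y 1 * Y 1 + Y 2 * Y 2) * h1 + h2 -
    (X 0 * Y 0 + X 1 * Y 1 + X 2 * Y 2) * h3

lemma inner_YX (h : IsRightFrame X Y N) : (inner ℝ Y X : ℝ) = 0 := by
  rw [real_inner_comm]; exact h.inner_XY

lemma inner_XN (h : IsRightFrame X Y N) : (inner ℝ X N : ℝ) = 0 := by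
  rw [real_inner_comm]; exact h.inner_NX

lemma inner_YN (h : IsRightFrame X Y N) : (inner ℝ Y N : ℝ) = 0 := by
  rw [real_inner_comm]; exact h.inner_NY

lemma mul_transpose (h : IsRightFrame X Y N) :
    frameMatrix X Y N * (frameMatrix X Y N).transpose = 1 := by
  rw [frameMatrix_mul_transpose, h.inner_XX, h.inner_XY, h.inner_XN, h.inner_YX, h.inner_YY,
    h.inner_YN, h.inner_NX, h.inner_NY, h.inner_NN, Matrix.one_fin_three]

lemma det_eq_one (h : IsRightFrame X Y N) : (frameMatrix X Y N).det = 1 := by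
  have h1 := h.inner_NN
  have h2 := h.eq_cross
  rw [frameMatrix_det]
  rw [inner_eq_coords] at h1
  have e0 : N 0 = _ := (congrArg (fun z : E3 => z 0) h2).trans (cross_apply_zero X Y)
  have e1 : N 1 = _ := (congrArg (fun z : E3 => z 1) h2).trans (cross_apply_one X Y)
  have e2 : N 2 = _ := (congrArg (fun z : E3 => z 2) h2).trans (cross_apply_two X Y)
  linear_combination h1 - N 0 * e0 - N 1 * e1 - N 2 * e2

lemma mem_specialOrthogonalGroup (h : IsRightFrame X Y N) :
    frameMatrix X Y N ∈ Matrix.specialOrthogonalGroup (Fin 3) ℝ := by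
  rw [Matrix.mem_specialOrthogonalGroup_iff, Matrix.mem_orthogonalGroup_iff]
  exact ⟨h.mul_transpose, h.det_eq_one⟩

/-- This is the form in which orthonormality is propagated: the entries of FᵀF and the determinant
are the quantities shown to be constant for a frame system. -/
lemma of_transpose_mul (h : (frameMatrix X Y N).transpose * frameMatrix X Y N = 1)
    (hdet : (frameMatrix X Y N).det = 1) : IsRightFrame X Y N := by
  have h' := frameMatrix_mul_transpose X Y N
  rw [mul_eq_one_comm.1 h] at h'
  have hc : ∀ i j, X i * X j + Y i * Y j + N i * N j = (1 : Matrix (Fin 3) (Fin 3) ℝ) i j := by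
    intro i j
    rw [← frameMatrix_transpose_mul_apply, h]
  rw [frameMatrix_det] at hdet
  refine ⟨?_, ?_, ?_, ?_⟩
  · simpa using (congrFun (congrFun h' 0) 0).symm
  · simpa using (congrFun (congrFun h' 1) 1).symm
  · simpa using (congrFun (congrFun h' 0) 1).symm
  -- Apply XXᵀ + YYᵀ + NNᵀ = 1 to X × Y: the first two terms vanish, and the third is N times the
  -- determinant, which is 1.
  · have k : ∀ i, N i * 1 = cross X Y i := by
      intro i
      have c0 := hc i 0
      have c1 := hc i 1
      have c2 := hc i 2
      have e := cross_apply_zero X Y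
      have e' := cross_apply_one X Y
      have e'' := cross_apply_two X Y
      have key : N i * 1 = (1 : Matrix (Fin 3) (Fin 3) ℝ) i 0 * cross X Y 0 +
          (1 : Matrix (Fin 3) (Fin 3) ℝ) i 1 * cross X Y 1 +
          (1 : Matrix (Fin 3) (Fin 3) ℝ) i 2 * cross X Y 2 := by
        rw [← hdet, ← c0, ← c1, ← c2, e, e', e'']
        ring
      rw [key, one_apply_sum]
    ext i
    simpa using k i

/-- An orthonormal expansion of the coordinates. -/
lemma eq_combination (h : IsRightFrame X Y N) {z : E3} {c₁ c₂ c₃ : ℝ}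
    (h1 : (inner ℝ z X : ℝ) = c₁) (h2 : (inner ℝ z Y : ℝ) = c₂) (h3 : (inner ℝ z N : ℝ) = c₃) :
    z = c₁ • X + c₂ • Y + c₃ • N := by
  have hc : ∀ i j, X i * X j + Y i * Y j + N i * N j = (1 : Matrix (Fin 3) (Fin 3) ℝ) i j := by
    intro i j
    rw [← frameMatrix_transpose_mul_apply, mul_eq_one_comm.1 h.mul_transpose]
  rw [inner_eq_coords] at h1 h2 h3
  have k : ∀ i, z i = c₁ * X i + c₂ * Y i + c₃ * N i := by
    intro i
    rw [← one_apply_sum z i, ← hc, ← hc, ← hc, ← h1, ← h2, ← h3]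
    ring
  ext i
  simpa using k i

end IsRightFrame

variable {r s κ τ : ℝ × ℝ → ℝ} {X Y N X' Y' N' : ℝ × ℝ → E3} {D : Set (ℝ × ℝ)}

/-- A frame system which is right oriented and orthonormal at one point is so everywhere. -/
lemma IsFrameSystem.isRightFrame (hD : IsOpen D) (hc : IsPreconnected D)
    (h : IsFrameSystem r s κ τ X Y N D) {p₀ : ℝ × ℝ} (hp₀ : p₀ ∈ D)
    (h₀ : IsRightFrame (X p₀) (Y p₀) (N p₀)) {p : ℝ × ℝ} (hp : p ∈ D) :
    IsRightFrame (X p) (Y p) (N p) := by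
  refine IsRightFrame.of_transpose_mul ?_ ?_
  · rw [← mul_eq_one_comm.1 h₀.mul_transpose]
    ext i j
    obtain ⟨c, hc⟩ := IsFrameSystem.exists_const hD hc h h i j
    rw [frameMatrix_transpose_mul_apply, frameMatrix_transpose_mul_apply, hc p hp, hc p₀ hp₀]
  · obtain ⟨c, hc⟩ := IsFrameSystem.exists_const_det hD hc h
    rw [← h₀.det_eq_one, frameMatrix_det, frameMatrix_det, hc p hp, hc p₀ hp₀]

/-- Two right oriented orthonormal frames with the same derivative equations differ by a rotation. -/
lemma IsFrameSystem.exists_rotation (hD : IsOpen D) (hc : IsConnected D)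
    (h : IsFrameSystem r s κ τ X Y N D) (h' : IsFrameSystem r s κ τ X' Y' N' D)
    (ho : ∀ p ∈ D, IsRightFrame (X p) (Y p) (N p))
    (ho' : ∀ p ∈ D, IsRightFrame (X' p) (Y' p) (N' p)) :
    ∃ A ∈ Matrix.specialOrthogonalGroup (Fin 3) ℝ, ∀ p ∈ D,
      Matrix.toEuclideanLin A (X p) = X' p ∧ Matrix.toEuclideanLin A (Y p) = Y' p := by
  obtain ⟨p₀, hp₀⟩ := hc.nonempty
  refine ⟨(frameMatrix (X' p₀) (Y' p₀) (N' p₀)).transpose * frameMatrix (X p₀) (Y p₀) (N p₀),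
    mul_mem ?_ (ho p₀ hp₀).mem_specialOrthogonalGroup, fun p hp => ?_⟩
  · have h1 := (ho' p₀ hp₀).mul_transpose
    rw [Matrix.mem_specialOrthogonalGroup_iff, Matrix.mem_orthogonalGroup_iff]
    refine ⟨?_, by rw [Matrix.det_transpose]; exact (ho' p₀ hp₀).det_eq_one⟩
    simpa [Matrix.star_eq_conjTranspose] using mul_eq_one_comm.1 h1
  · have hA : (frameMatrix (X' p₀) (Y' p₀) (N' p₀)).transpose * frameMatrix (X p₀) (Y p₀) (N p₀) =
        (frameMatrix (X' p) (Y' p) (N' p)).transpose * frameMatrix (X p) (Y p) (N p) := by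
      ext i j
      obtain ⟨c, hc⟩ := IsFrameSystem.exists_const hD hc.isPreconnected h h' i j
      rw [frameMatrix_transpose_mul_apply, frameMatrix_transpose_mul_apply, hc p hp, hc p₀ hp₀]
    have o := ho p hp
    have o1 := o.inner_XX
    have o2 := o.inner_YX
    have o3 := o.inner_NX
    have o4 := o.inner_YY
    have o5 := o.inner_NY
    rw [inner_eq_coords] at o1 o2 o3 o4 o5
    rw [hA]
    constructor
    · ext i
      simp only [Matrix.toLpLin_apply, Matrix.mulVec, dotProduct, Fin.sum_univ_three,
        frameMatrix_transpose_mul_apply]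
      linear_combination X' p i * o1 + Y' p i * o2 + N' p i * o3
    · ext i
      simp only [Matrix.toLpLin_apply, Matrix.mulVec, dotProduct, Fin.sum_univ_three,
        frameMatrix_transpose_mul_apply]
      linear_combination X' p i * o2 + Y' p i * o4 + N' p i * o5

end Frames

/-! ### The exponential factors and the coefficients built from them -/

section Coefficients

variable {h k : ℝ → ℝ} {I : Set ℝ} {t₀ : ℝ}

lemma expInt_pos (h k : ℝ → ℝ) (t₀ t : ℝ) : 0 < expInt h k t₀ t := Real.exp_pos _

lemma hasDerivAt_expInt (hIo : IsOpen I) (hIc : I.OrdConnected)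
    (hh : ContDiffOn ℝ 1 h I) (hk : ContDiffOn ℝ 1 k I) (hne : ∀ t ∈ I, h t - k t ≠ 0)
    (ht₀ : t₀ ∈ I) {t : ℝ} (ht : t ∈ I) :
    HasDerivAt (expInt h k t₀) (expInt h k t₀ t * (deriv h t / (h t - k t))) t := by
  have hcont : ContinuousOn (fun s => deriv h s / (h s - k s)) I :=
    (hh.continuousOn_deriv_of_isOpen hIo le_rfl).div (hh.continuousOn.sub hk.continuousOn) hne
  have hsub : uIcc t₀ t ⊆ I := hIc.uIcc_subset ht₀ ht
  exact (intervalIntegral.integral_hasDerivAt_right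
    ((hcont.mono hsub).intervalIntegrable) (hcont.stronglyMeasurableAtFilter hIo t ht)
    (hcont.continuousAt (hIo.mem_nhds ht))).exp

lemma contDiffOn_deriv_div (hIo : IsOpen I) {m : ℕ} (hh : ContDiffOn ℝ (m + 1) h I)
    (hk : ContDiffOn ℝ (m + 1) k I) (hne : ∀ t ∈ I, h t - k t ≠ 0) :
    ContDiffOn ℝ m (fun s => deriv h s / (h s - k s)) I :=
  (hh.deriv_of_isOpen hIo le_rfl).div ((hh.of_le le_self_add).sub (hk.of_le le_self_add)) hne

lemma contDiffOn_expInt (hIo : IsOpen I) (hIc : I.OrdConnected) {m : ℕ}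
    (hh : ContDiffOn ℝ (m + 1) h I) (hk : ContDiffOn ℝ (m + 1) k I)
    (hne : ∀ t ∈ I, h t - k t ≠ 0) (ht₀ : t₀ ∈ I) : ContDiffOn ℝ (m + 1) (expInt h k t₀) I := by
  have hcont := contDiffOn_deriv_div hIo hh hk hne
  have hd : ∀ t ∈ I, HasDerivAt (fun t => ∫ s in t₀..t, deriv h s / (h s - k s))
      (deriv h t / (h t - k t)) t := fun t ht =>
    intervalIntegral.integral_hasDerivAt_right
      ((hcont.continuousOn.mono (hIc.uIcc_subset ht₀ ht)).intervalIntegrable)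
      (hcont.continuousOn.stronglyMeasurableAtFilter hIo t ht)
      (hcont.continuousOn.continuousAt (hIo.mem_nhds ht))
  refine ContDiffOn.exp ?_
  rw [contDiffOn_succ_iff_deriv_of_isOpen hIo]
  refine ⟨fun t ht => (hd t ht).differentiableAt.differentiableWithinAt, by simp, ?_⟩
  exact hcont.congr fun t ht => (hd t ht).deriv

/-- The signed length of the coordinate vector prescribed by the invariants. -/
def scale (h k : ℝ → ℝ) (c t₀ : ℝ) (ν : ℝ × ℝ → ℝ) (p : ℝ × ℝ) : ℝ := (c * expInt h k t₀ (ν p))⁻¹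

/-- The coefficient of the differential of `ν` in the connection form of the frame. -/
def connCoeff (h k : ℝ → ℝ) (c d t₀ t : ℝ) : ℝ :=
  d * expInt k h t₀ t / (c * expInt h k t₀ t) * (deriv h t / (h t - k t))

/-- Write P and Q for the factors in the denominator and the numerator. The logarithmic derivative
of Q/P is -(h' + k')/(h - k), and differentiating h'/(h - k) contributes -h'(h' - k')/(h - k)². The
terms with k' cancel, which leaves the bracket of the second order equation for ν. -/
lemma hasDerivAt_connCoeff (hIo : IsOpen I) (hIc : I.OrdConnected)
    (hh : ContDiffOn ℝ 2 h I) (hk : ContDiffOn ℝ 2 k I) (hne : ∀ t ∈ I, h t - k t ≠ 0)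
    {c : ℝ} (hc : c ≠ 0) (d : ℝ) (ht₀ : t₀ ∈ I) {t : ℝ} (ht : t ∈ I) :
    HasDerivAt (connCoeff h k c d t₀)
      (d * expInt k h t₀ t / (c * expInt h k t₀ t * (h t - k t)) *
        (deriv (deriv h) t - 2 * deriv h t ^ 2 / (h t - k t))) t := by
  have hne' : ∀ t ∈ I, k t - h t ≠ 0 := fun t ht e => hne t ht (by linarith)
  have hh1 : ContDiffOn ℝ 1 h I := hh.of_le one_le_two
  have hk1 : ContDiffOn ℝ 1 k I := hk.of_le one_le_two
  have dh : HasDerivAt h (deriv h t) t :=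
    ((hh1.differentiableOn one_ne_zero).differentiableAt (hIo.mem_nhds ht)).hasDerivAt
  have dk : HasDerivAt k (deriv k t) t :=
    ((hk1.differentiableOn one_ne_zero).differentiableAt (hIo.mem_nhds ht)).hasDerivAt
  have dh' : HasDerivAt (deriv h) (deriv (deriv h) t) t :=
    (((hh.deriv_of_isOpen (m := 1) hIo (by norm_num)).differentiableOn one_ne_zero).differentiableAt
      (hIo.mem_nhds ht)).hasDerivAt
  have dP := hasDerivAt_expInt hIo hIc hh1 hk1 hne ht₀ ht
  have dQ := hasDerivAt_expInt hIo hIc hk1 hh1 hne' ht₀ ht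
  have hP := (expInt_pos h k t₀ t).ne'
  have hh0 := hne t ht
  have hcP : c * expInt h k t₀ t ≠ 0 := mul_ne_zero hc hP
  have := ((dQ.const_mul d).div (dP.const_mul c) hcP).mul (dh'.div (dh.sub dk) hh0)
  refine this.congr_deriv ?_
  have e : k t - h t = -(h t - k t) := by ring
  rw [e]
  simp only [Pi.div_apply, Pi.sub_apply]
  set w := h t - k t
  field_simp
  ring

lemma contDiffOn_connCoeff (hIo : IsOpen I) (hIc : I.OrdConnected) {m : ℕ}
    (hh : ContDiffOn ℝ (m + 1) h I) (hk : ContDiffOn ℝ (m + 1) k I)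
    (hne : ∀ t ∈ I, h t - k t ≠ 0) {c : ℝ} (hc : c ≠ 0) (d : ℝ) (ht₀ : t₀ ∈ I) :
    ContDiffOn ℝ m (connCoeff h k c d t₀) I := by
  have hne' : ∀ t ∈ I, k t - h t ≠ 0 := fun t ht e => hne t ht (by linarith)
  have hP := (contDiffOn_expInt hIo hIc hh hk hne ht₀).of_le (le_self_add (b := 1))
  have hQ := (contDiffOn_expInt hIo hIc hk hh hne' ht₀).of_le (le_self_add (b := 1))
  exact ((contDiffOn_const.mul hQ).div (contDiffOn_const.mul hP)
    fun t _ => mul_ne_zero hc (expInt_pos h k t₀ t).ne').mul (contDiffOn_deriv_div hIo hh hk hne)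

variable {D : Set (ℝ × ℝ)} {ν : ℝ × ℝ → ℝ}

lemma contDiffOn_scale (hIo : IsOpen I) (hIc : I.OrdConnected) {m : ℕ}
    (hh : ContDiffOn ℝ (m + 1) h I) (hk : ContDiffOn ℝ (m + 1) k I)
    (hne : ∀ t ∈ I, h t - k t ≠ 0) {c : ℝ} (hc : c ≠ 0) (ht₀ : t₀ ∈ I)
    (hν : ContDiffOn ℝ (m + 1) ν D) (hνI : ∀ p ∈ D, ν p ∈ I) :
    ContDiffOn ℝ (m + 1) (scale h k c t₀ ν) D :=
  (contDiffOn_const.mul ((contDiffOn_expInt hIo hIc hh hk hne ht₀).comp hν hνI)).inv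
    fun _ _ => mul_ne_zero hc (expInt_pos _ _ _ _).ne'

lemma scale_ne_zero {c : ℝ} (hc : c ≠ 0) (p : ℝ × ℝ) : scale h k c t₀ ν p ≠ 0 :=
  inv_ne_zero (mul_ne_zero hc (expInt_pos _ _ _ _).ne')

lemma hasDerivAt_scale_factor (hIo : IsOpen I) (hIc : I.OrdConnected)
    (hh : ContDiffOn ℝ 1 h I) (hk : ContDiffOn ℝ 1 k I) (hne : ∀ t ∈ I, h t - k t ≠ 0)
    {c : ℝ} (hc : c ≠ 0) (ht₀ : t₀ ∈ I) {t : ℝ} (ht : t ∈ I) :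
    HasDerivAt (fun t => (c * expInt h k t₀ t)⁻¹)
      (-((c * expInt h k t₀ t)⁻¹ * (deriv h t / (h t - k t)))) t := by
  have hP := (expInt_pos h k t₀ t).ne'
  refine ((hasDerivAt_expInt hIo hIc hh hk hne ht₀ ht).const_mul c).fun_inv
    (mul_ne_zero hc hP) |>.congr_deriv ?_
  have := hne t ht
  field_simp

end Coefficients

/-! ### Regularity of the frame and of the immersion -/

section Regularity

lemma differentiableAt_comp {φ : ℝ → ℝ} {φ' : ℝ} {h : ℝ × ℝ → ℝ} {p : ℝ × ℝ}
    (hφ : HasDerivAt φ φ' (h p)) (hh : DifferentiableAt ℝ h p) :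
    DifferentiableAt ℝ (fun q => φ (h q)) p :=
  (hφ.comp_hasFDerivAt p hh.hasFDerivAt).differentiableAt

variable {V : Type*} [NormedAddCommGroup V] [NormedSpace ℝ V]

lemma contDiffOn_succ_of_du_dv {D : Set (ℝ × ℝ)} (hD : IsOpen D) {h : ℝ × ℝ → V} {m : ℕ}
    (hh : ∀ p ∈ D, DifferentiableAt ℝ h p) (hu : ContDiffOn ℝ m (du h) D)
    (hv : ContDiffOn ℝ m (dv h) D) : ContDiffOn ℝ (m + 1) h D := by
  rw [contDiffOn_succ_iff_fderiv_of_isOpen hD]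
  refine ⟨fun p hp => (hh p hp).differentiableWithinAt, by simp, ?_⟩
  have : ContDiffOn ℝ m (fun p => (ContinuousLinearMap.fst ℝ ℝ ℝ).smulRight (du h p) +
      (ContinuousLinearMap.snd ℝ ℝ ℝ).smulRight (dv h p)) D :=
    (contDiffOn_const.smulRight hu).add (contDiffOn_const.smulRight hv)
  refine this.congr fun p _ => ?_
  refine ContinuousLinearMap.ext fun w => ?_
  simp [fderiv_eq_of_du_dv h p w]

/-- Bootstrap: the frame equations express the derivatives of X, Y, N by the vectors themselves, so
each step gains one order up to that of the coefficients. -/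
lemma IsFrameSystem.contDiffOn {r s κ τ : ℝ × ℝ → ℝ} {X Y N : ℝ × ℝ → E3} {D : Set (ℝ × ℝ)}
    (hD : IsOpen D) (h : IsFrameSystem r s κ τ X Y N D) (m : ℕ) (hr : ContDiffOn ℝ m r D)
    (hs : ContDiffOn ℝ m s D) (hκ : ContDiffOn ℝ m κ D) (hτ : ContDiffOn ℝ m τ D) :
    ContDiffOn ℝ m X D ∧ ContDiffOn ℝ m Y D ∧ ContDiffOn ℝ m N D := by
  induction m with
  | zero =>
    refine ⟨?_, ?_, ?_⟩ <;> rw [Nat.cast_zero, contDiffOn_zero]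
    exacts [fun p hp => (h.diffX p hp).continuousAt.continuousWithinAt,
      fun p hp => (h.diffY p hp).continuousAt.continuousWithinAt,
      fun p hp => (h.diffN p hp).continuousAt.continuousWithinAt]
  | succ m ih =>
    have hle : (m : WithTop ℕ∞) ≤ ((m + 1 : ℕ) : WithTop ℕ∞) := by exact_mod_cast Nat.le_succ m
    have hr' := hr.of_le hle
    have hs' := hs.of_le hle
    have hκ' := hκ.of_le hle
    have hτ' := hτ.of_le hle
    obtain ⟨iX, iY, iN⟩ := ih hr' hs' hκ' hτ'
    push_cast
    exact ⟨contDiffOn_succ_of_du_dv hD h.diffX (((hr'.smul iY).add (hκ'.smul iN)).congr h.du_X)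
        ((hs'.smul iY).congr h.dv_X),
      contDiffOn_succ_of_du_dv hD h.diffY ((hr'.smul iX).neg.congr h.du_Y)
        (((hs'.smul iX).neg.add (hτ'.smul iN)).congr h.dv_Y),
      contDiffOn_succ_of_du_dv hD h.diffN ((hκ'.smul iX).neg.congr h.du_N)
        ((hτ'.smul iY).neg.congr h.dv_N)⟩

end Regularity

/-! ### The Weingarten relation near a point -/

/-- Locally, one function of a parameter is a differentiable function of another one. -/
lemma exists_function_of_deriv_ne_zero {f g : ℝ → ℝ} {t₀ : ℝ} (hf : ContDiffAt ℝ 1 f t₀)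
    (hg : ContDiffAt ℝ 1 g t₀) (hf' : deriv f t₀ ≠ 0) :
    ∃ (J : Set ℝ) (w : ℝ → ℝ), IsOpen J ∧ J.OrdConnected ∧ DifferentiableOn ℝ w J ∧
      ∀ᶠ t in 𝓝 t₀, f t ∈ J ∧ g t = w (f t) := by
  have hd : HasStrictDerivAt f (deriv f t₀) t₀ := hf.hasStrictDerivAt one_ne_zero
  have hd' : HasFDerivAt f
      (ContinuousLinearEquiv.unitsEquivAut ℝ (Units.mk0 (deriv f t₀) hf') : ℝ →L[ℝ] ℝ) t₀ :=
    (hd.hasStrictFDerivAt_equiv hf').hasFDerivAt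
  set φ := hf.localInverse hd' one_ne_zero with hφ
  have hleft : ∀ᶠ t in 𝓝 t₀, φ (f t) = t :=
    (hf.hasStrictFDerivAt' hd' one_ne_zero).eventually_left_inverse
  have hw : ContDiffAt ℝ 1 (g ∘ φ) (f t₀) := by
    refine ContDiffAt.comp _ ?_ (hf.to_localInverse hd' one_ne_zero)
    have : hf.localInverse hd' one_ne_zero (f t₀) = t₀ := hleft.self_of_nhds
    rw [← this] at hg
    exact hg
  -- Being C¹ at one point implies being C¹ nearby, which supplies an interval on which w is
  -- differentiable.
  obtain ⟨η, hη, hball⟩ := Metric.eventually_nhds_iff_ball.1 (hw.eventually (by simp))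
  refine ⟨ball (f t₀) η, g ∘ φ, isOpen_ball, ?_, fun y hy =>
    ((hball y hy).differentiableAt one_ne_zero).differentiableWithinAt, ?_⟩
  · rw [Real.ball_eq_Ioo]; exact ordConnected_Ioo
  · filter_upwards [hleft, hf.continuousAt.preimage_mem_nhds (ball_mem_nhds _ hη)] with t h1 h2
    exact ⟨h2, by simp [h1]⟩

/-! ### Invariants of an immersion with an adapted frame -/

section Immersion

variable {α β r s κ τ : ℝ × ℝ → ℝ} {x X Y N : ℝ × ℝ → E3} {D : Set (ℝ × ℝ)}

/-- The immersion `x` has the orthonormal principal frame `X, Y, N`, and the coordinate vectors have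
the signed lengths `α, β`. -/
structure IsAdapted (α β r s κ τ : ℝ × ℝ → ℝ) (x X Y N : ℝ × ℝ → E3) (D : Set (ℝ × ℝ)) :
    Prop where
  isOpen : IsOpen D
  diff_α : ∀ p ∈ D, DifferentiableAt ℝ α p
  diff_β : ∀ p ∈ D, DifferentiableAt ℝ β p
  du_eq : ∀ p ∈ D, du x p = α p • X p
  dv_eq : ∀ p ∈ D, dv x p = β p • Y p
  dv_α : ∀ p ∈ D, dv α p = -(β p * r p)
  du_β : ∀ p ∈ D, du β p = α p * s p
  frame : IsFrameSystem r s κ τ X Y N D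
  ortho : ∀ p ∈ D, IsRightFrame (X p) (Y p) (N p)

namespace IsAdapted

lemma coeffE_eq (h : IsAdapted α β r s κ τ x X Y N D) {p : ℝ × ℝ} (hp : p ∈ D) :
    coeffE x p = α p * α p := by
  rw [coeffE, h.du_eq p hp, inner_smul_left, inner_smul_right, (h.ortho p hp).inner_XX]
  simp

lemma coeffF_eq (h : IsAdapted α β r s κ τ x X Y N D) {p : ℝ × ℝ} (hp : p ∈ D) :
    coeffF x p = 0 := by
  rw [coeffF, h.du_eq p hp, h.dv_eq p hp, inner_smul_left, inner_smul_right,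
    (h.ortho p hp).inner_XY]
  simp

lemma coeffG_eq (h : IsAdapted α β r s κ τ x X Y N D) {p : ℝ × ℝ} (hp : p ∈ D) :
    coeffG x p = β p * β p := by
  rw [coeffG, h.dv_eq p hp, inner_smul_left, inner_smul_right, (h.ortho p hp).inner_YY]
  simp

lemma sqrt_coeffE (h : IsAdapted α β r s κ τ x X Y N D) {p : ℝ × ℝ} (hp : p ∈ D) :
    √(coeffE x p) = |α p| := by
  rw [h.coeffE_eq hp, Real.sqrt_mul_self_eq_abs]

lemma sqrt_coeffG (h : IsAdapted α β r s κ τ x X Y N D) {p : ℝ × ℝ} (hp : p ∈ D) :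
    √(coeffG x p) = |β p| := by
  rw [h.coeffG_eq hp, Real.sqrt_mul_self_eq_abs]

/-- The sign conditions on ε and δ identify the oriented unit coordinate vectors with X and Y;
without them the normal is only determined up to sign. -/
lemma normal_eq (h : IsAdapted α β r s κ τ x X Y N D) {ε δ : ℝ} {p : ℝ × ℝ} (hp : p ∈ D)
    (hα : α p ≠ 0) (hβ : β p ≠ 0) (hε : ε * α p = |α p|) (hδ : δ * β p = |β p|) :
    normal ε δ x p = N p := by
  have hX : frameX ε x p = X p := by
    rw [frameX, h.sqrt_coeffE hp, h.du_eq p hp, smul_smul, div_mul_eq_mul_div, hε,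
      div_self (abs_ne_zero.2 hα), one_smul]
  have hY : frameY δ x p = Y p := by
    rw [frameY, h.sqrt_coeffG hp, h.dv_eq p hp, smul_smul, div_mul_eq_mul_div, hδ,
      div_self (abs_ne_zero.2 hβ), one_smul]
  rw [normal, hX, hY, (h.ortho p hp).eq_cross]

lemma inner_du_du (h : IsAdapted α β r s κ τ x X Y N D) {p : ℝ × ℝ} (hp : p ∈ D) :
    (inner ℝ (du (du x) p) (N p) : ℝ) = α p * κ p := by
  have o := h.ortho p hp
  rw [du_congr_on h.isOpen h.du_eq hp, du_smul (h.diff_α p hp) (h.frame.diffX p hp),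
    h.frame.du_X p hp]
  simp [inner_add_left, inner_smul_left, o.inner_YN, o.inner_XN, o.inner_NN,
    -inner_self_eq_norm_sq_to_K]

lemma inner_dv_du (h : IsAdapted α β r s κ τ x X Y N D) {p : ℝ × ℝ} (hp : p ∈ D) :
    (inner ℝ (dv (du x) p) (N p) : ℝ) = 0 := by
  have o := h.ortho p hp
  rw [dv_congr_on h.isOpen h.du_eq hp, dv_smul (h.diff_α p hp) (h.frame.diffX p hp),
    h.frame.dv_X p hp]
  simp [inner_add_left, inner_smul_left, o.inner_YN, o.inner_XN]

lemma inner_dv_dv (h : IsAdapted α β r s κ τ x X Y N D) {p : ℝ × ℝ} (hp : p ∈ D) :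
    (inner ℝ (dv (dv x) p) (N p) : ℝ) = β p * τ p := by
  have o := h.ortho p hp
  rw [dv_congr_on h.isOpen h.dv_eq hp, dv_smul (h.diff_β p hp) (h.frame.diffY p hp),
    h.frame.dv_Y p hp]
  simp [inner_add_left, inner_smul_left, o.inner_YN, o.inner_XN, o.inner_NN,
    -inner_self_eq_norm_sq_to_K]

lemma gamma1_eq (h : IsAdapted α β r s κ τ x X Y N D) {δ : ℝ} {p : ℝ × ℝ} (hp : p ∈ D)
    (hα : α p ≠ 0) (hβ : β p ≠ 0) (hδ : δ * β p = |β p|) : gamma1 δ x p = r p / α p := by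
  rw [gamma1, h.sqrt_coeffG hp, dv_congr_on h.isOpen (fun q hq => h.coeffE_eq hq) hp,
    dv_mul (h.diff_α p hp) (h.diff_α p hp), h.dv_α p hp, h.coeffE_eq hp, ← hδ]
  have : δ ≠ 0 := by
    rintro rfl
    rw [zero_mul] at hδ
    exact abs_ne_zero.2 hβ hδ.symm
  field_simp
  ring

lemma gamma2_eq (h : IsAdapted α β r s κ τ x X Y N D) {ε : ℝ} {p : ℝ × ℝ} (hp : p ∈ D)
    (hα : α p ≠ 0) (hβ : β p ≠ 0) (hε : ε * α p = |α p|) : gamma2 ε x p = s p / β p := by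
  rw [gamma2, h.sqrt_coeffE hp, du_congr_on h.isOpen (fun q hq => h.coeffG_eq hq) hp,
    du_mul (h.diff_β p hp) (h.diff_β p hp), h.du_β p hp, h.coeffG_eq hp, ← hε]
  have : ε ≠ 0 := by
    rintro rfl
    rw [zero_mul] at hε
    exact abs_ne_zero.2 hα hε.symm
  field_simp
  ring

lemma isPrincipal (h : IsAdapted α β r s κ τ x X Y N D) {n : ℕ∞} (hx : ContDiffOn ℝ n x D)
    {ε δ : ℝ} (hα : ∀ p ∈ D, α p ≠ 0) (hβ : ∀ p ∈ D, β p ≠ 0) (hε1 : ε = 1 ∨ ε = -1)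
    (hδ1 : δ = 1 ∨ δ = -1) (hε : ∀ p ∈ D, ε * α p = |α p|) (hδ : ∀ p ∈ D, δ * β p = |β p|) :
    IsPrincipal n ε δ x D where
  sign_u := hε1
  sign_v := hδ1
  contDiffOn := hx
  regular p hp := by
    rw [LinearIndependent.pair_iff]
    intro c d hcd
    have o := h.ortho p hp
    rw [h.du_eq p hp, h.dv_eq p hp] at hcd
    have h1 := congrArg (fun z => (inner ℝ z (X p) : ℝ)) hcd
    have h2 := congrArg (fun z => (inner ℝ z (Y p) : ℝ)) hcd
    simp only [inner_add_left, inner_smul_left, o.inner_XX, o.inner_YX, o.inner_XY, o.inner_YY,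
      inner_zero_left] at h1 h2
    have := hα p hp
    have := hβ p hp
    simp_all
  coeffF_eq_zero p hp := h.coeffF_eq hp
  coeffM_eq_zero p hp := by
    rw [coeffM, h.normal_eq hp (hα p hp) (hβ p hp) (hε p hp) (hδ p hp), h.inner_dv_du hp]

lemma nu1_eq (h : IsAdapted α β r s κ τ x X Y N D) {ε δ : ℝ} {p : ℝ × ℝ} (hp : p ∈ D)
    (hα : α p ≠ 0) (hβ : β p ≠ 0) (hε : ε * α p = |α p|) (hδ : δ * β p = |β p|) :
    nu1 ε δ x p = κ p / α p := by
  rw [nu1, coeffL, h.normal_eq hp hα hβ hε hδ, h.inner_du_du hp, h.coeffE_eq hp]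
  field_simp

lemma nu2_eq (h : IsAdapted α β r s κ τ x X Y N D) {ε δ : ℝ} {p : ℝ × ℝ} (hp : p ∈ D)
    (hα : α p ≠ 0) (hβ : β p ≠ 0) (hε : ε * α p = |α p|) (hδ : δ * β p = |β p|) :
    nu2 ε δ x p = τ p / β p := by
  rw [nu2, coeffN, h.normal_eq hp hα hβ hε hδ, h.inner_dv_dv hp, h.coeffG_eq hp]
  field_simp

end IsAdapted

end Immersion

/-! ### The data determined by the prescribed invariants -/

section Prescribed

/-- Functions `f, g` of `ν` prescribing the invariants. -/
structure IsPrescription (f g : ℝ → ℝ) (I : Set ℝ) (a b t₀ : ℝ) (ν : ℝ × ℝ → ℝ)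
    (D : Set (ℝ × ℝ)) : Prop where
  isOpen_I : IsOpen I
  ordConnected : I.OrdConnected
  contDiff_f : ContDiffOn ℝ 2 f I
  contDiff_g : ContDiffOn ℝ 2 g I
  ne : ∀ t ∈ I, f t - g t ≠ 0
  deriv_f_ne : ∀ t ∈ I, deriv f t ≠ 0
  deriv_g_ne : ∀ t ∈ I, deriv g t ≠ 0
  mem_t₀ : t₀ ∈ I
  isOpen : IsOpen D
  contDiff_ν : ContDiffOn ℝ 2 ν D
  mapsTo : ∀ p ∈ D, ν p ∈ I
  du_ne : ∀ p ∈ D, du ν p ≠ 0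
  dv_ne : ∀ p ∈ D, dv ν p ≠ 0
  ha : a ≠ 0
  hb : b ≠ 0

/-- The component `⟨X_u, Y⟩` of the connection form. -/
def connU (f g : ℝ → ℝ) (a b t₀ : ℝ) (ν : ℝ × ℝ → ℝ) (p : ℝ × ℝ) : ℝ :=
  connCoeff f g a b t₀ (ν p) * dv ν p

/-- The component `⟨X_v, Y⟩` of the connection form. -/
def connV (f g : ℝ → ℝ) (a b t₀ : ℝ) (ν : ℝ × ℝ → ℝ) (p : ℝ × ℝ) : ℝ :=
  -(connCoeff g f b a t₀ (ν p) * du ν p)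

namespace IsPrescription

variable {f g : ℝ → ℝ} {I : Set ℝ} {a b t₀ : ℝ} {ν : ℝ × ℝ → ℝ} {D : Set (ℝ × ℝ)}
  {p : ℝ × ℝ}

lemma mono {D₁ : Set (ℝ × ℝ)} (h : IsPrescription f g I a b t₀ ν D) (hD₁ : IsOpen D₁)
    (hs : D₁ ⊆ D) : IsPrescription f g I a b t₀ ν D₁ :=
  { h with
    isOpen := hD₁
    contDiff_ν := h.contDiff_ν.mono hs
    mapsTo := fun p hp => h.mapsTo p (hs hp)
    du_ne := fun p hp => h.du_ne p (hs hp)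
    dv_ne := fun p hp => h.dv_ne p (hs hp) }

lemma ne' (h : IsPrescription f g I a b t₀ ν D) : ∀ t ∈ I, g t - f t ≠ 0 :=
  fun t ht e => h.ne t ht (by linarith)

lemma contDiff_f_one (h : IsPrescription f g I a b t₀ ν D) : ContDiffOn ℝ 1 f I :=
  h.contDiff_f.of_le one_le_two

lemma contDiff_g_one (h : IsPrescription f g I a b t₀ ν D) : ContDiffOn ℝ 1 g I :=
  h.contDiff_g.of_le one_le_two

lemma diff_ν (h : IsPrescription f g I a b t₀ ν D) (hp : p ∈ D) : DifferentiableAt ℝ ν p :=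
  (h.contDiff_ν.differentiableOn two_ne_zero).differentiableAt (h.isOpen.mem_nhds hp)

lemma hasDerivAt_f (h : IsPrescription f g I a b t₀ ν D) {t : ℝ} (ht : t ∈ I) :
    HasDerivAt f (deriv f t) t :=
  ((h.contDiff_f.differentiableOn two_ne_zero).differentiableAt
    (h.isOpen_I.mem_nhds ht)).hasDerivAt

lemma hasDerivAt_g (h : IsPrescription f g I a b t₀ ν D) {t : ℝ} (ht : t ∈ I) :
    HasDerivAt g (deriv g t) t :=
  ((h.contDiff_g.differentiableOn two_ne_zero).differentiableAt
    (h.isOpen_I.mem_nhds ht)).hasDerivAt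

lemma diff_f (h : IsPrescription f g I a b t₀ ν D) (hp : p ∈ D) :
    DifferentiableAt ℝ (fun q => f (ν q)) p :=
  differentiableAt_comp (h.hasDerivAt_f (h.mapsTo p hp)) (h.diff_ν hp)

lemma diff_g (h : IsPrescription f g I a b t₀ ν D) (hp : p ∈ D) :
    DifferentiableAt ℝ (fun q => g (ν q)) p :=
  differentiableAt_comp (h.hasDerivAt_g (h.mapsTo p hp)) (h.diff_ν hp)

lemma hasDerivAt_α (h : IsPrescription f g I a b t₀ ν D) (hp : p ∈ D) :
    HasDerivAt (fun t => (a * expInt f g t₀ t)⁻¹)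
      (-(scale f g a t₀ ν p * (deriv f (ν p) / (f (ν p) - g (ν p))))) (ν p) :=
  hasDerivAt_scale_factor h.isOpen_I h.ordConnected h.contDiff_f_one h.contDiff_g_one h.ne
    h.ha h.mem_t₀ (h.mapsTo p hp)

lemma hasDerivAt_β (h : IsPrescription f g I a b t₀ ν D) (hp : p ∈ D) :
    HasDerivAt (fun t => (b * expInt g f t₀ t)⁻¹)
      (-(scale g f b t₀ ν p * (deriv g (ν p) / (g (ν p) - f (ν p))))) (ν p) :=
  hasDerivAt_scale_factor h.isOpen_I h.ordConnected h.contDiff_g_one h.contDiff_f_one h.ne'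
    h.hb h.mem_t₀ (h.mapsTo p hp)

lemma diff_α (h : IsPrescription f g I a b t₀ ν D) (hp : p ∈ D) :
    DifferentiableAt ℝ (scale f g a t₀ ν) p :=
  differentiableAt_comp (φ := fun t => (a * expInt f g t₀ t)⁻¹) (h.hasDerivAt_α hp) (h.diff_ν hp)

lemma diff_β (h : IsPrescription f g I a b t₀ ν D) (hp : p ∈ D) :
    DifferentiableAt ℝ (scale g f b t₀ ν) p :=
  differentiableAt_comp (φ := fun t => (b * expInt g f t₀ t)⁻¹) (h.hasDerivAt_β hp) (h.diff_ν hp)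

/-- Since P'/P = f'/(f - g), the factor α = 1/(aP) satisfies α_v = -α f'ν_v/(f - g), and `connU` is
chosen as -α_v/β. -/
lemma dv_α (h : IsPrescription f g I a b t₀ ν D) (hp : p ∈ D) :
    dv (scale f g a t₀ ν) p = -(scale g f b t₀ ν p * connU f g a b t₀ ν p) := by
  refine (dv_comp (h.hasDerivAt_α hp) (h.diff_ν hp)).trans ?_
  have := (expInt_pos f g t₀ (ν p)).ne'
  have := (expInt_pos g f t₀ (ν p)).ne'
  have := h.ne _ (h.mapsTo p hp)
  have := h.ha
  have := h.hb
  simp only [connU, connCoeff, scale]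
  field_simp

lemma du_β (h : IsPrescription f g I a b t₀ ν D) (hp : p ∈ D) :
    du (scale g f b t₀ ν) p = scale f g a t₀ ν p * connV f g a b t₀ ν p := by
  refine (du_comp (h.hasDerivAt_β hp) (h.diff_ν hp)).trans ?_
  have := (expInt_pos f g t₀ (ν p)).ne'
  have := (expInt_pos g f t₀ (ν p)).ne'
  have := h.ne' _ (h.mapsTo p hp)
  have := h.ha
  have := h.hb
  simp only [connV, connCoeff, scale]
  field_simp

/-- The Codazzi equation holds identically in ν: (fα)' = f'α - f f'α/(f - g) = -g f'α/(f - g). -/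
lemma dv_κ (h : IsPrescription f g I a b t₀ ν D) (hp : p ∈ D) :
    dv (fun q => f (ν q) * scale f g a t₀ ν q) p =
      -(g (ν p) * scale g f b t₀ ν p * connU f g a b t₀ ν p) := by
  rw [dv_mul (h.diff_f hp) (h.diff_α hp), h.dv_α hp,
    dv_comp (h.hasDerivAt_f (h.mapsTo p hp)) (h.diff_ν hp)]
  have := (expInt_pos f g t₀ (ν p)).ne'
  have := (expInt_pos g f t₀ (ν p)).ne'
  have := h.ne _ (h.mapsTo p hp)
  have := h.ha
  have := h.hb
  simp only [connU, connCoeff, scale]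
  field_simp
  ring

lemma du_τ (h : IsPrescription f g I a b t₀ ν D) (hp : p ∈ D) :
    du (fun q => g (ν q) * scale g f b t₀ ν q) p =
      f (ν p) * scale f g a t₀ ν p * connV f g a b t₀ ν p := by
  rw [du_mul (h.diff_g hp) (h.diff_β hp), h.du_β hp,
    du_comp (h.hasDerivAt_g (h.mapsTo p hp)) (h.diff_ν hp)]
  have := (expInt_pos f g t₀ (ν p)).ne'
  have := (expInt_pos g f t₀ (ν p)).ne'
  have := h.ne' _ (h.mapsTo p hp)
  have := h.ha
  have := h.hb
  simp only [connV, connCoeff, scale]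
  field_simp
  ring

/-- The Gauss equation. -/
lemma dv_connU_sub_du_connV (h : IsPrescription f g I a b t₀ ν D) (hp : p ∈ D)
    (hpde : GeometricPDE f g a b t₀ ν p) :
    dv (connU f g a b t₀ ν) p - du (connV f g a b t₀ ν) p =
      f (ν p) * scale f g a t₀ ν p * (g (ν p) * scale g f b t₀ ν p) := by
  have hI := h.mapsTo p hp
  have d1 := hasDerivAt_connCoeff h.isOpen_I h.ordConnected h.contDiff_f h.contDiff_g h.ne h.ha b
    h.mem_t₀ hI
  have d2 := hasDerivAt_connCoeff h.isOpen_I h.ordConnected h.contDiff_g h.contDiff_f h.ne' h.hb a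
    h.mem_t₀ hI
  have dvν : DifferentiableAt ℝ (dv ν) p :=
    ((contDiffOn_dv (m := 1) h.isOpen (by norm_num) h.contDiff_ν).differentiableOn
      one_ne_zero).differentiableAt (h.isOpen.mem_nhds hp)
  have duν : DifferentiableAt ℝ (du ν) p :=
    ((contDiffOn_du (m := 1) h.isOpen (by norm_num) h.contDiff_ν).differentiableOn
      one_ne_zero).differentiableAt (h.isOpen.mem_nhds hp)
  have e1 : dv (connU f g a b t₀ ν) p = _ :=
    dv_mul (differentiableAt_comp d1 (h.diff_ν hp)) dvν
  have e2 : du (connV f g a b t₀ ν) p = _ := (du_neg _).trans (congrArg Neg.neg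
    (du_mul (differentiableAt_comp d2 (h.diff_ν hp)) duν))
  rw [e1, e2, dv_comp d1 (h.diff_ν hp), du_comp d2 (h.diff_ν hp)]
  have hP := (expInt_pos f g t₀ (ν p)).ne'
  have hQ := (expInt_pos g f t₀ (ν p)).ne'
  have hw := h.ne _ hI
  have ha := h.ha
  have hb := h.hb
  unfold GeometricPDE at hpde
  simp only [connCoeff, scale]
  -- Everything is rewritten over the single denominator f - g. P, Q and this difference then become
  -- free symbols, and the claim is the equation for ν with denominators cleared.
  have e : g (ν p) - f (ν p) = -(f (ν p) - g (ν p)) := by ring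
  rw [e] at hpde ⊢
  generalize expInt f g t₀ (ν p) = P at *
  generalize expInt g f t₀ (ν p) = Q at *
  generalize f (ν p) - g (ν p) = w at *
  field_simp at hpde ⊢
  linear_combination hpde

lemma connU_div_α (h : IsPrescription f g I a b t₀ ν D) (p : ℝ × ℝ) :
    connU f g a b t₀ ν p / scale f g a t₀ ν p = presGamma1 f g b t₀ ν p := by
  have := (expInt_pos f g t₀ (ν p)).ne'
  have := h.ha
  simp only [connU, connCoeff, scale, presGamma1]
  field_simp

lemma connV_div_β (h : IsPrescription f g I a b t₀ ν D) (p : ℝ × ℝ) :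
    connV f g a b t₀ ν p / scale g f b t₀ ν p = presGamma2 f g a t₀ ν p := by
  have := (expInt_pos g f t₀ (ν p)).ne'
  have := h.hb
  simp only [connV, connCoeff, scale, presGamma2]
  field_simp

lemma presGamma1_ne (h : IsPrescription f g I a b t₀ ν D) (hp : p ∈ D) :
    presGamma1 f g b t₀ ν p ≠ 0 := by
  have hI := h.mapsTo p hp
  exact mul_ne_zero (mul_ne_zero (expInt_pos _ _ _ _).ne'
    (div_ne_zero (mul_ne_zero h.hb (h.deriv_f_ne _ hI)) (h.ne _ hI))) (h.dv_ne p hp)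

lemma presGamma2_ne (h : IsPrescription f g I a b t₀ ν D) (hp : p ∈ D) :
    presGamma2 f g a t₀ ν p ≠ 0 := by
  have hI := h.mapsTo p hp
  exact neg_ne_zero.2 (mul_ne_zero (mul_ne_zero (expInt_pos _ _ _ _).ne'
    (div_ne_zero (mul_ne_zero h.ha (h.deriv_g_ne _ hI)) (h.ne' _ hI))) (h.du_ne p hp))

end IsPrescription

end Prescribed

/-! ### Existence of the surface -/

section LocalExistence

variable {f g : ℝ → ℝ} {I : Set ℝ} {a b t₀ : ℝ} {ν : ℝ × ℝ → ℝ} {D : Set (ℝ × ℝ)}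

/-- The metric factors keep the full order m + 1, whereas the connection involves first derivatives
of f, g and ν and loses one order. -/
lemma IsPrescription.contDiffOn_coeffs (h : IsPrescription f g I a b t₀ ν D) {m : ℕ}
    (hf : ContDiffOn ℝ (m + 1) f I) (hg : ContDiffOn ℝ (m + 1) g I)
    (hν : ContDiffOn ℝ (m + 1) ν D) :
    ContDiffOn ℝ (m + 1) (scale f g a t₀ ν) D ∧ ContDiffOn ℝ (m + 1) (scale g f b t₀ ν) D ∧
    ContDiffOn ℝ m (connU f g a b t₀ ν) D ∧ ContDiffOn ℝ m (connV f g a b t₀ ν) D ∧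
    ContDiffOn ℝ m (fun p => f (ν p) * scale f g a t₀ ν p) D ∧
    ContDiffOn ℝ m (fun p => g (ν p) * scale g f b t₀ ν p) D := by
  have hle : (m : WithTop ℕ∞) ≤ m + 1 := le_self_add
  have hα := contDiffOn_scale h.isOpen_I h.ordConnected hf hg h.ne h.ha h.mem_t₀ hν h.mapsTo
  have hβ := contDiffOn_scale h.isOpen_I h.ordConnected hg hf h.ne' h.hb h.mem_t₀ hν h.mapsTo
  have hν' := hν.of_le hle
  refine ⟨hα, hβ, ?_, ?_, ?_, ?_⟩
  · exact ((contDiffOn_connCoeff h.isOpen_I h.ordConnected hf hg h.ne h.ha b h.mem_t₀).comp hν'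
      h.mapsTo).mul (contDiffOn_dv h.isOpen le_rfl hν)
  · exact (((contDiffOn_connCoeff h.isOpen_I h.ordConnected hg hf h.ne' h.hb a h.mem_t₀).comp hν'
      h.mapsTo).mul (contDiffOn_du h.isOpen le_rfl hν)).neg
  · exact (((hf.comp hν h.mapsTo).mul hα).of_le hle)
  · exact (((hg.comp hν h.mapsTo).mul hβ).of_le hle)

lemma sign_mul_scale (h k : ℝ → ℝ) {c : ℝ} (hc : c ≠ 0) (t₀ : ℝ) (ν : ℝ × ℝ → ℝ) (p : ℝ × ℝ) :
    Real.sign c * scale h k c t₀ ν p = |scale h k c t₀ ν p| := by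
  have hP := expInt_pos h k t₀ (ν p)
  unfold scale
  rcases lt_or_gt_of_ne hc with h0 | h0
  · rw [Real.sign_of_neg h0, abs_of_neg (inv_lt_zero.2 (mul_neg_of_neg_of_pos h0 hP))]; ring
  · rw [Real.sign_of_pos h0, abs_of_pos (inv_pos.2 (mul_pos h0 hP)), one_mul]

lemma sign_eq_one_or {c : ℝ} (hc : c ≠ 0) : Real.sign c = 1 ∨ Real.sign c = -1 := by
  rcases lt_or_gt_of_ne hc with h0 | h0
  · exact Or.inr (Real.sign_of_neg h0)
  · exact Or.inl (Real.sign_of_pos h0)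

/-- The bootstrap runs through finite orders only; this covers n = ∞ as well. -/
lemma contDiffOn_of_forall_nat {n : ℕ∞} {x : ℝ × ℝ → E3} (hn : 1 ≤ n)
    (h : ∀ m : ℕ, ((m + 1 : ℕ) : ℕ∞) ≤ n → ContDiffOn ℝ (m + 1) x D) : ContDiffOn ℝ n x D := by
  rw [contDiffOn_iff_forall_nat_le]
  intro k hk
  cases k with
  | zero => exact (h 0 (by simpa using hn)).of_le (by simp)
  | succ m => exact_mod_cast h m (by exact_mod_cast hk)

/-- Local existence of a surface with prescribed invariants. -/
theorem IsPrescription.exists_solution (h : IsPrescription f g I a b t₀ ν D) {n : ℕ∞} (hn : 2 ≤ n)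
    (hf : ContDiffOn ℝ n f I) (hg : ContDiffOn ℝ n g I) (hν : ContDiffOn ℝ n ν D)
    (hpde : ∀ p ∈ D, GeometricPDE f g a b t₀ ν p) {p₀ : ℝ × ℝ} (hp₀ : p₀ ∈ D) :
    ∃ ρ > 0, ball p₀ ρ ⊆ D ∧ ∃ x : ℝ × ℝ → E3,
      IsSolution n f g a b t₀ ν (Real.sign a) (Real.sign b) x (ball p₀ ρ) := by
  have e2 : ((1 : ℕ) : WithTop ℕ∞) + 1 = 2 := by norm_num
  obtain ⟨cα, cβ, cr, cs, cκ, cτ⟩ := h.contDiffOn_coeffs (m := 1) (by rw [e2]; exact h.contDiff_f)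
    (by rw [e2]; exact h.contDiff_g) (by rw [e2]; exact h.contDiff_ν)
  rw [e2] at cα cβ
  rw [Nat.cast_one] at cr cs cκ cτ
  obtain ⟨ρ, hρ, hball, x, X, Y, N, hx, hfr, hX0, hY0, hN0⟩ :=
    exists_frameSystem h.isOpen (cα.of_le one_le_two) (cβ.of_le one_le_two) cr cs cκ cτ
      (fun p hp => h.dv_α hp) (fun p hp => h.du_β hp) (fun p hp => h.dv_κ hp)
      (fun p hp => h.du_τ hp) (fun p hp => h.dv_connU_sub_du_connV hp (hpde p hp)) hp₀
  -- The inverse of f exists only near ν(p₀), so the ball is shrunk until f(ν) stays in the domain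
  -- of w.
  have hI0 := h.isOpen_I.mem_nhds (h.mapsTo p₀ hp₀)
  obtain ⟨J, w, hJo, hJc, hw, hev⟩ := exists_function_of_deriv_ne_zero
    (h.contDiff_f_one.contDiffAt hI0) (h.contDiff_g_one.contDiffAt hI0)
    (h.deriv_f_ne _ (h.mapsTo p₀ hp₀))
  obtain ⟨ρ', hρ', hev'⟩ := Metric.eventually_nhds_iff_ball.1
    ((h.diff_ν hp₀).continuousAt.eventually hev)
  have hs1 : ball p₀ (min ρ ρ') ⊆ ball p₀ ρ := ball_subset_ball (min_le_left _ _)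
  have hs2 : ball p₀ (min ρ ρ') ⊆ ball p₀ ρ' := ball_subset_ball (min_le_right _ _)
  have hsD := hs1.trans hball
  have h0 : IsRightFrame (X p₀) (Y p₀) (N p₀) := by
    rw [hX0, hY0, hN0]
    refine ⟨by simp, by simp, by simp [inner_eq_coords], ?_⟩
    ext i
    fin_cases i
    · exact (by simp : (EuclideanSpace.single 2 (1 : ℝ) : E3) 0 = _).trans (cross_apply_zero _ _).symm
    · exact (by simp : (EuclideanSpace.single 2 (1 : ℝ) : E3) 1 = _).trans (cross_apply_one _ _).symm
    · exact (by simp : (EuclideanSpace.single 2 (1 : ℝ) : E3) 2 = _).trans (cross_apply_two _ _).symm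
  have hortho : ∀ p ∈ ball p₀ ρ, IsRightFrame (X p) (Y p) (N p) := fun p hp =>
    hfr.isRightFrame isOpen_ball (convex_ball p₀ ρ).isPreconnected (mem_ball_self hρ) h0 hp
  have had : IsAdapted (scale f g a t₀ ν) (scale g f b t₀ ν) (connU f g a b t₀ ν)
      (connV f g a b t₀ ν) (fun p => f (ν p) * scale f g a t₀ ν p)
      (fun p => g (ν p) * scale g f b t₀ ν p) x X Y N (ball p₀ ρ) :=
    { isOpen := isOpen_ball
      diff_α := fun p hp => h.diff_α (hball hp)
      diff_β := fun p hp => h.diff_β (hball hp)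
      du_eq := fun p hp => (hx p hp).2.1
      dv_eq := fun p hp => (hx p hp).2.2
      dv_α := fun p hp => h.dv_α (hball hp)
      du_β := fun p hp => h.du_β (hball hp)
      frame := hfr
      ortho := hortho }
  have hα : ∀ p, scale f g a t₀ ν p ≠ 0 := scale_ne_zero h.ha
  have hβ : ∀ p, scale g f b t₀ ν p ≠ 0 := scale_ne_zero h.hb
  have hε := sign_mul_scale f g h.ha t₀ ν
  have hδ := sign_mul_scale g f h.hb t₀ ν
  -- With data of class C^(m+1) the frame is C^m and α, β are at least C^m, so x_u = αX and x_v = βY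
  -- are C^m and x regains the lost order.
  have hxn : ContDiffOn ℝ n x (ball p₀ ρ) := by
    refine contDiffOn_of_forall_nat (one_le_two.trans hn) fun m hm => ?_
    have hm' : (m : WithTop ℕ∞) + 1 ≤ n := by exact_mod_cast hm
    obtain ⟨cα, cβ, cr, cs, cκ, cτ⟩ := (h.mono isOpen_ball hball).contDiffOn_coeffs
      (hf.of_le hm') (hg.of_le hm') ((hν.mono hball).of_le hm')
    obtain ⟨cX, cY, -⟩ := hfr.contDiffOn isOpen_ball m cr cs cκ cτ
    exact contDiffOn_succ_of_du_dv isOpen_ball (fun p hp => (hx p hp).1)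
      (((cα.of_le le_self_add).smul cX).congr had.du_eq)
      (((cβ.of_le le_self_add).smul cY).congr had.dv_eq)
  have hinv : HasInvariants (Real.sign a) (Real.sign b) x (ball p₀ (min ρ ρ'))
      (fun p => f (ν p)) (fun p => g (ν p)) (presGamma1 f g b t₀ ν) (presGamma2 f g a t₀ ν) :=
    { nu1_eq := fun p hp => by
        rw [had.nu1_eq (hs1 hp) (hα p) (hβ p) (hε p) (hδ p), mul_div_assoc, div_self (hα p), mul_one]
      nu2_eq := fun p hp => by
        rw [had.nu2_eq (hs1 hp) (hα p) (hβ p) (hε p) (hδ p), mul_div_assoc, div_self (hβ p), mul_one]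
      gamma1_eq := fun p hp => by
        rw [had.gamma1_eq (hs1 hp) (hα p) (hβ p) (hδ p), h.connU_div_α]
      gamma2_eq := fun p hp => by
        rw [had.gamma2_eq (hs1 hp) (hα p) (hβ p) (hε p), h.connV_div_β] }
  refine ⟨min ρ ρ', lt_min hρ hρ', hsD, x, ⟨⟨?_, fun p hp => ?_, ?_⟩, hinv⟩⟩
  · have hp := had.isPrincipal hxn (fun p _ => hα p) (fun p _ => hβ p) (sign_eq_one_or h.ha)
      (sign_eq_one_or h.hb) (fun p _ => hε p) fun p _ => hδ p
    exact ⟨hp.sign_u, hp.sign_v, hp.contDiffOn.mono hs1, fun p h => hp.regular p (hs1 h),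
      fun p h => hp.coeffF_eq_zero p (hs1 h), fun p h => hp.coeffM_eq_zero p (hs1 h)⟩
  · rw [hinv.nu1_eq p hp, hinv.nu2_eq p hp, hinv.gamma1_eq p hp, hinv.gamma2_eq p hp]
    exact mul_ne_zero (mul_ne_zero (h.ne _ (h.mapsTo p (hsD hp))) (h.presGamma1_ne (hsD hp)))
      (h.presGamma2_ne (hsD hp))
  · refine ⟨J, w, hJo, hJc, hw, fun p hp => ?_⟩
    rw [hinv.nu1_eq p hp, hinv.nu2_eq p hp]
    exact hev' p (hs2 hp)

end LocalExistence

/-! ### Mixed derivatives and differentiated inner products -/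

section Symmetry

variable {V : Type*} [NormedAddCommGroup V] [NormedSpace ℝ V] {h : ℝ × ℝ → V} {D : Set (ℝ × ℝ)}
  {p : ℝ × ℝ}

/-- Differentiability of both first partials at the point makes the total derivative differentiable
there, and this suffices for symmetry. Continuous second derivatives are not required, which lets
the lemma apply to the normal of a C² surface. -/
lemma dv_du_eq_du_dv (hD : IsOpen D) (hp : p ∈ D) (hh : ∀ q ∈ D, DifferentiableAt ℝ h q)
    (hu : DifferentiableAt ℝ (du h) p) (hv : DifferentiableAt ℝ (dv h) p) :
    dv (du h) p = du (dv h) p := by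
  have hf : fderiv ℝ h = fun q => (ContinuousLinearMap.fst ℝ ℝ ℝ).smulRight (du h q) +
      (ContinuousLinearMap.snd ℝ ℝ ℝ).smulRight (dv h q) := by
    funext q
    refine ContinuousLinearMap.ext fun w => ?_
    simp [fderiv_eq_of_du_dv h q w]
  have hd : DifferentiableAt ℝ (fderiv ℝ h) p := by
    rw [hf]
    exact (((ContinuousLinearMap.smulRightL ℝ (ℝ × ℝ) V
        (ContinuousLinearMap.fst ℝ ℝ ℝ)).differentiableAt.comp p hu).add
      ((ContinuousLinearMap.smulRightL ℝ (ℝ × ℝ) V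
        (ContinuousLinearMap.snd ℝ ℝ ℝ)).differentiableAt.comp p hv))
  have hsymm := second_derivative_symmetric_of_eventually (f := h) (f' := fderiv ℝ h) (x := p)
    (by filter_upwards [hD.mem_nhds hp] with q hq using (hh q hq).hasFDerivAt) hd.hasFDerivAt
    (0, 1) (1, 0)
  have e1 : dv (du h) p = fderiv ℝ (fderiv ℝ h) p (0, 1) (1, 0) :=
    dv_clm_comp (ContinuousLinearMap.apply ℝ V ((1 : ℝ), (0 : ℝ))) hd
  have e2 : du (dv h) p = fderiv ℝ (fderiv ℝ h) p (1, 0) (0, 1) :=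
    du_clm_comp (ContinuousLinearMap.apply ℝ V ((0 : ℝ), (1 : ℝ))) hd
  rw [e1, e2, hsymm]

lemma inner_du_eq_neg (hD : IsOpen D) (hp : p ∈ D) {y z : ℝ × ℝ → E3} {c : ℝ}
    (hy : DifferentiableAt ℝ y p) (hz : DifferentiableAt ℝ z p)
    (hc : ∀ q ∈ D, (inner ℝ (y q) (z q) : ℝ) = c) :
    (inner ℝ (du y p) (z p) : ℝ) = -inner ℝ (du z p) (y p) := by
  have h1 := du_inner hy hz
  rw [du_congr_on hD hc hp, du_const, real_inner_comm] at h1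
  linarith

lemma inner_dv_eq_neg (hD : IsOpen D) (hp : p ∈ D) {y z : ℝ × ℝ → E3} {c : ℝ}
    (hy : DifferentiableAt ℝ y p) (hz : DifferentiableAt ℝ z p)
    (hc : ∀ q ∈ D, (inner ℝ (y q) (z q) : ℝ) = c) :
    (inner ℝ (dv y p) (z p) : ℝ) = -inner ℝ (dv z p) (y p) := by
  have h1 := dv_inner hy hz
  rw [dv_congr_on hD hc hp, dv_const, real_inner_comm] at h1
  linarith

end Symmetry

/-! ### Rodrigues and Codazzi equations in class C² -/

namespace IsPrincipal

variable {ε δ : ℝ} {x : ℝ × ℝ → E3} {D : Set (ℝ × ℝ)} {p : ℝ × ℝ}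

lemma sign_u_sq (h : IsPrincipal 2 ε δ x D) : ε * ε = 1 := by
  rcases h.sign_u with e | e <;> rw [e] <;> norm_num

lemma sign_v_sq (h : IsPrincipal 2 ε δ x D) : δ * δ = 1 := by
  rcases h.sign_v with e | e <;> rw [e] <;> norm_num

lemma contDiffOn_two (h : IsPrincipal 2 ε δ x D) : ContDiffOn ℝ 2 x D := h.contDiffOn

lemma coeffE_pos (h : IsPrincipal 2 ε δ x D) (hp : p ∈ D) : 0 < coeffE x p :=
  real_inner_self_pos.2 ((h.regular p hp).ne_zero 0)

lemma coeffG_pos (h : IsPrincipal 2 ε δ x D) (hp : p ∈ D) : 0 < coeffG x p :=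
  real_inner_self_pos.2 ((h.regular p hp).ne_zero 1)

variable (hD : IsOpen D) (h : IsPrincipal 2 ε δ x D) (hp : p ∈ D)
include hD h hp

lemma diff_x : DifferentiableAt ℝ x p :=
  (h.contDiffOn_two.differentiableOn two_ne_zero).differentiableAt (hD.mem_nhds hp)

lemma diff_du : DifferentiableAt ℝ (du x) p :=
  ((contDiffOn_du (m := 1) hD (by norm_num) h.contDiffOn_two).differentiableOn
    one_ne_zero).differentiableAt (hD.mem_nhds hp)

lemma diff_dv : DifferentiableAt ℝ (dv x) p :=
  ((contDiffOn_dv (m := 1) hD (by norm_num) h.contDiffOn_two).differentiableOn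
    one_ne_zero).differentiableAt (hD.mem_nhds hp)

lemma dv_du_comm : dv (du x) p = du (dv x) p :=
  dv_du_eq_du_dv hD hp (fun _ hq => h.diff_x hD hq) (h.diff_du hD hp) (h.diff_dv hD hp)

lemma diff_frameX : DifferentiableAt ℝ (frameX ε x) p := by
  have hE : DifferentiableAt ℝ (coeffE x) p := (h.diff_du hD hp).inner ℝ (h.diff_du hD hp)
  have hpos := h.coeffE_pos hp
  have hc : DifferentiableAt ℝ (fun q => ε / √(coeffE x q)) p :=
    ((hE.sqrt hpos.ne').fun_inv (Real.sqrt_pos.2 hpos).ne').const_mul ε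
  exact hc.smul (h.diff_du hD hp)

lemma diff_frameY : DifferentiableAt ℝ (frameY δ x) p := by
  have hG : DifferentiableAt ℝ (coeffG x) p := (h.diff_dv hD hp).inner ℝ (h.diff_dv hD hp)
  have hpos := h.coeffG_pos hp
  have hc : DifferentiableAt ℝ (fun q => δ / √(coeffG x q)) p :=
    ((hG.sqrt hpos.ne').fun_inv (Real.sqrt_pos.2 hpos).ne').const_mul δ
  exact hc.smul (h.diff_dv hD hp)

lemma diff_normal : DifferentiableAt ℝ (normal ε δ x) p := by
  have hX := fun i => (hasFDerivAt_coord (h.diff_frameX hD hp) i).differentiableAt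
  have hY := fun i => (hasFDerivAt_coord (h.diff_frameY hD hp) i).differentiableAt
  refine differentiableAt_euclidean.2 fun i => ?_
  fin_cases i
  · exact (((hX 1).mul (hY 2)).sub ((hX 2).mul (hY 1))).congr_of_eventuallyEq
      (Eventually.of_forall fun q => cross_apply_zero _ _)
  · exact (((hX 2).mul (hY 0)).sub ((hX 0).mul (hY 2))).congr_of_eventuallyEq
      (Eventually.of_forall fun q => cross_apply_one _ _)
  · exact (((hX 0).mul (hY 1)).sub ((hX 1).mul (hY 0))).congr_of_eventuallyEq
      (Eventually.of_forall fun q => cross_apply_two _ _)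

omit hD in
lemma du_eq_smul_frameX : du x p = (ε * √(coeffE x p)) • frameX ε x p := by
  have := (Real.sqrt_pos.2 (h.coeffE_pos hp)).ne'
  rw [frameX, smul_smul, mul_div_assoc', mul_right_comm, h.sign_u_sq, one_mul, div_self this,
    one_smul]

omit hD in
lemma dv_eq_smul_frameY : dv x p = (δ * √(coeffG x p)) • frameY δ x p := by
  have := (Real.sqrt_pos.2 (h.coeffG_pos hp)).ne'
  rw [frameY, smul_smul, mul_div_assoc', mul_right_comm, h.sign_v_sq, one_mul, div_self this,
    one_smul]

omit hD in
lemma isRightFrame : IsRightFrame (frameX ε x p) (frameY δ x p) (normal ε δ x p) := by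
  have hE := h.coeffE_pos hp
  have hG := h.coeffG_pos hp
  have sE := Real.mul_self_sqrt hE.le
  have sG := Real.mul_self_sqrt hG.le
  have e1 := h.sign_u_sq
  have e2 := h.sign_v_sq
  have hF := h.coeffF_eq_zero p hp
  refine ⟨?_, ?_, ?_, rfl⟩
  · rw [frameX, real_inner_smul_left, real_inner_smul_right, ← coeffE]
    have := (Real.sqrt_pos.2 hE).ne'
    field_simp
    linear_combination coeffE x p * e1 - sE
  · rw [frameY, real_inner_smul_left, real_inner_smul_right, ← coeffG]
    have := (Real.sqrt_pos.2 hG).ne'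
    field_simp
    linear_combination coeffG x p * e2 - sG
  · rw [frameX, frameY, real_inner_smul_left, real_inner_smul_right, ← coeffF, hF, mul_zero,
      mul_zero]

lemma inner_du_normal_du :
    (inner ℝ (du (normal ε δ x) p) (du x p) : ℝ) = -coeffL ε δ x p :=
  inner_du_eq_neg hD hp (h.diff_normal hD hp) (h.diff_du hD hp) fun q hq => by
    rw [h.du_eq_smul_frameX hq, real_inner_smul_right, (h.isRightFrame hq).inner_NX, mul_zero]

lemma inner_dv_normal_du :
    (inner ℝ (dv (normal ε δ x) p) (du x p) : ℝ) = 0 := by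
  rw [inner_dv_eq_neg (c := 0) hD hp (h.diff_normal hD hp) (h.diff_du hD hp) fun q hq => by
    rw [h.du_eq_smul_frameX hq, real_inner_smul_right, (h.isRightFrame hq).inner_NX, mul_zero],
    ← coeffM, h.coeffM_eq_zero p hp, neg_zero]

lemma inner_dv_normal_dv :
    (inner ℝ (dv (normal ε δ x) p) (dv x p) : ℝ) = -coeffN ε δ x p :=
  inner_dv_eq_neg hD hp (h.diff_normal hD hp) (h.diff_dv hD hp) fun q hq => by
    rw [h.dv_eq_smul_frameY hq, real_inner_smul_right, (h.isRightFrame hq).inner_NY, mul_zero]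

lemma inner_du_normal_dv :
    (inner ℝ (du (normal ε δ x) p) (dv x p) : ℝ) = 0 := by
  rw [inner_du_eq_neg (c := 0) hD hp (h.diff_normal hD hp) (h.diff_dv hD hp) fun q hq => by
    rw [h.dv_eq_smul_frameY hq, real_inner_smul_right, (h.isRightFrame hq).inner_NY, mul_zero],
    ← h.dv_du_comm hD hp, ← coeffM, h.coeffM_eq_zero p hp, neg_zero]

lemma inner_du_normal_normal : (inner ℝ (du (normal ε δ x) p) (normal ε δ x p) : ℝ) = 0 := by
  have := inner_du_eq_neg (c := 1) hD hp (h.diff_normal hD hp) (h.diff_normal hD hp) fun q hq =>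
    (h.isRightFrame hq).inner_NN
  linarith

lemma inner_dv_normal_normal : (inner ℝ (dv (normal ε δ x) p) (normal ε δ x p) : ℝ) = 0 := by
  have := inner_dv_eq_neg (c := 1) hD hp (h.diff_normal hD hp) (h.diff_normal hD hp) fun q hq =>
    (h.isRightFrame hq).inner_NN
  linarith

/-- Rodrigues' formula. -/
lemma du_normal : du (normal ε δ x) p = -(nu1 ε δ x p • du x p) := by
  have hE := h.coeffE_pos hp
  have hsE := (Real.sqrt_pos.2 hE).ne'
  have hexp := (h.isRightFrame hp).eq_combination (z := du (normal ε δ x) p)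
    (c₁ := -(ε * coeffL ε δ x p / √(coeffE x p))) (c₂ := 0) (c₃ := 0)
    (by rw [frameX, real_inner_smul_right, h.inner_du_normal_du hD hp]; ring)
    (by rw [frameY, real_inner_smul_right, h.inner_du_normal_dv hD hp, mul_zero])
    (h.inner_du_normal_normal hD hp)
  rw [hexp, zero_smul, zero_smul, add_zero, add_zero, nu1, h.du_eq_smul_frameX hp, smul_smul,
    ← neg_smul]
  congr 1
  have := Real.mul_self_sqrt hE.le
  field_simp
  linear_combination ε * coeffL ε δ x p * this

/-- Rodrigues' formula. -/
lemma dv_normal : dv (normal ε δ x) p = -(nu2 ε δ x p • dv x p) := by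
  have hG := h.coeffG_pos hp
  have hsG := (Real.sqrt_pos.2 hG).ne'
  have hexp := (h.isRightFrame hp).eq_combination (z := dv (normal ε δ x) p)
    (c₁ := 0) (c₂ := -(δ * coeffN ε δ x p / √(coeffG x p))) (c₃ := 0)
    (by rw [frameX, real_inner_smul_right, h.inner_dv_normal_du hD hp, mul_zero])
    (by rw [frameY, real_inner_smul_right, h.inner_dv_normal_dv hD hp]; ring)
    (h.inner_dv_normal_normal hD hp)
  rw [hexp, zero_smul, zero_smul, add_zero, zero_add, nu2, h.dv_eq_smul_frameY hp, smul_smul,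
    ← neg_smul]
  congr 1
  have := Real.mul_self_sqrt hG.le
  field_simp
  linear_combination δ * coeffN ε δ x p * this

/-- The Codazzi equations, in vector form. -/
lemma codazzi {n₁ n₂ : ℝ × ℝ → ℝ} (h1 : ∀ q ∈ D, nu1 ε δ x q = n₁ q)
    (h2 : ∀ q ∈ D, nu2 ε δ x q = n₂ q) (d1 : DifferentiableAt ℝ n₁ p)
    (d2 : DifferentiableAt ℝ n₂ p) :
    (n₁ p - n₂ p) • dv (du x) p = du n₂ p • dv x p - dv n₁ p • du x p := by
  have eu : ∀ q ∈ D, du (normal ε δ x) q = -(n₁ q • du x q) := fun q hq => by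
    rw [h.du_normal hD hq, h1 q hq]
  have ev : ∀ q ∈ D, dv (normal ε δ x) q = -(n₂ q • dv x q) := fun q hq => by
    rw [h.dv_normal hD hq, h2 q hq]
  have hnear := hD.mem_nhds hp
  -- The surface is only C², so its normal is a priori only C¹. By Rodrigues its partials are -n₁
  -- x_u and -n₂ x_v, which are differentiable at p because n₁ and n₂ are.
  have key := dv_du_eq_du_dv hD hp (fun _ hq => h.diff_normal hD hq)
    ((d1.smul (h.diff_du hD hp)).neg.congr_of_eventuallyEq
      (by filter_upwards [hnear] with q hq using eu q hq))
    ((d2.smul (h.diff_dv hD hp)).neg.congr_of_eventuallyEq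
      (by filter_upwards [hnear] with q hq using ev q hq))
  rw [dv_congr_on hD eu hp, du_congr_on hD ev hp, dv_neg, du_neg, dv_smul d1 (h.diff_du hD hp),
    du_smul d2 (h.diff_dv hD hp), ← h.dv_du_comm hD hp, neg_inj] at key
  rw [sub_smul, sub_eq_sub_iff_add_eq_add, key, add_comm]

lemma codazzi_E {n₁ n₂ : ℝ × ℝ → ℝ} (h1 : ∀ q ∈ D, nu1 ε δ x q = n₁ q)
    (h2 : ∀ q ∈ D, nu2 ε δ x q = n₂ q) (d1 : DifferentiableAt ℝ n₁ p)
    (d2 : DifferentiableAt ℝ n₂ p) :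
    (n₁ p - n₂ p) * dv (coeffE x) p = -(2 * dv n₁ p * coeffE x p) := by
  have key := congrArg (fun z => (inner ℝ z (du x p) : ℝ)) (h.codazzi hD hp h1 h2 d1 d2)
  have e : dv (coeffE x) p = _ := dv_inner (h.diff_du hD hp) (h.diff_du hD hp)
  have hF : (inner ℝ (dv x p) (du x p) : ℝ) = 0 := by
    rw [real_inner_comm]; exact h.coeffF_eq_zero p hp
  simp only [inner_sub_left, real_inner_smul_left, hF] at key
  rw [e, real_inner_comm (dv (du x) p)]
  rw [← coeffE] at key
  linear_combination 2 * key

lemma codazzi_G {n₁ n₂ : ℝ × ℝ → ℝ} (h1 : ∀ q ∈ D, nu1 ε δ x q = n₁ q)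
    (h2 : ∀ q ∈ D, nu2 ε δ x q = n₂ q) (d1 : DifferentiableAt ℝ n₁ p)
    (d2 : DifferentiableAt ℝ n₂ p) :
    (n₁ p - n₂ p) * du (coeffG x) p = 2 * du n₂ p * coeffG x p := by
  have key := congrArg (fun z => (inner ℝ z (dv x p) : ℝ)) (h.codazzi hD hp h1 h2 d1 d2)
  have e : du (coeffG x) p = _ := du_inner (h.diff_dv hD hp) (h.diff_dv hD hp)
  have hF : (inner ℝ (du x p) (dv x p) : ℝ) = 0 := h.coeffF_eq_zero p hp
  simp only [inner_sub_left, real_inner_smul_left, hF] at key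
  rw [e, real_inner_comm (du (dv x) p), ← h.dv_du_comm hD hp]
  rw [← coeffG] at key
  linear_combination 2 * key

end IsPrincipal

/-! ### Recovering the metric from the invariants -/

section Converse

variable {f g : ℝ → ℝ} {I : Set ℝ} {a b t₀ : ℝ} {ν : ℝ × ℝ → ℝ} {D : Set (ℝ × ℝ)}
  {ε δ : ℝ} {x : ℝ × ℝ → E3}

/-- By Codazzi, E_v = -2E f'ν_v/(f - g), so γ₁ = δ f'ν_v/((f - g)√G). Equating this with the
prescribed γ₁ and cancelling f'ν_v gives δ/√G = bQ. In particular δ is forced to be the sign of b.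
-/
lemma IsPrescription.sqrt_coeffG (h : IsPrescription f g I a b t₀ ν D)
    (hx : IsSolution 2 f g a b t₀ ν ε δ x D) {p : ℝ × ℝ} (hp : p ∈ D) :
    δ * √(coeffG x p) = scale g f b t₀ ν p := by
  obtain ⟨⟨hpr, -, -⟩, hinv⟩ := hx
  have hI := h.mapsTo p hp
  have hE := h.ne _ hI
  have cod := hpr.codazzi_E h.isOpen hp hinv.nu1_eq hinv.nu2_eq (h.diff_f hp) (h.diff_g hp)
  rw [dv_comp (h.hasDerivAt_f hI) (h.diff_ν hp)] at cod
  have hγ := hinv.gamma1_eq p hp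
  have hf' := h.deriv_f_ne _ hI
  have hν' := h.dv_ne p hp
  have hEpos := (hpr.coeffE_pos hp).ne'
  have hG := (Real.sqrt_pos.2 (hpr.coeffG_pos hp)).ne'
  have hQ := (expInt_pos g f t₀ (ν p)).ne'
  have hb := h.hb
  have hδ := hpr.sign_v_sq
  unfold gamma1 presGamma1 at hγ
  unfold scale
  have e : dv (coeffE x) p = -(2 * (deriv f (ν p) * dv ν p) * coeffE x p) / (f (ν p) - g (ν p)) := by
    rw [eq_div_iff hE, ← cod]; ring
  rw [e] at hγ
  field_simp at hγ
  refine eq_inv_of_mul_eq_one_left ?_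
  linear_combination hδ - δ * hγ

lemma IsPrescription.sqrt_coeffE (h : IsPrescription f g I a b t₀ ν D)
    (hx : IsSolution 2 f g a b t₀ ν ε δ x D) {p : ℝ × ℝ} (hp : p ∈ D) :
    ε * √(coeffE x p) = scale f g a t₀ ν p := by
  obtain ⟨⟨hpr, -, -⟩, hinv⟩ := hx
  have hI := h.mapsTo p hp
  have hE := h.ne' _ hI
  have cod := hpr.codazzi_G h.isOpen hp hinv.nu1_eq hinv.nu2_eq (h.diff_f hp) (h.diff_g hp)
  rw [du_comp (h.hasDerivAt_g hI) (h.diff_ν hp)] at cod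
  have hγ := hinv.gamma2_eq p hp
  have hg' := h.deriv_g_ne _ hI
  have hν' := h.du_ne p hp
  have hGpos := (hpr.coeffG_pos hp).ne'
  have hsE := (Real.sqrt_pos.2 (hpr.coeffE_pos hp)).ne'
  have hP := (expInt_pos f g t₀ (ν p)).ne'
  have ha := h.ha
  have hε := hpr.sign_u_sq
  unfold gamma2 presGamma2 at hγ
  unfold scale
  have e : du (coeffG x) p =
      -(2 * (deriv g (ν p) * du ν p) * coeffG x p) / (g (ν p) - f (ν p)) := by
    rw [eq_div_iff hE, ← cod]; ring
  rw [e] at hγ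
  field_simp at hγ
  refine eq_inv_of_mul_eq_one_left ?_
  linear_combination hε + ε * hγ

end Converse

/-! ### Uniqueness up to motion and geometric parameters -/

section Converse

variable {f g : ℝ → ℝ} {I : Set ℝ} {a b t₀ : ℝ} {ν : ℝ × ℝ → ℝ} {D : Set (ℝ × ℝ)}
  {ε δ ε' δ' : ℝ} {x y : ℝ × ℝ → E3}

/-- Any solution is adapted to its frame, with the connection form prescribed by the invariants. -/
lemma IsPrescription.isAdapted (h : IsPrescription f g I a b t₀ ν D)
    (hx : IsSolution 2 f g a b t₀ ν ε δ x D) :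
    IsAdapted (scale f g a t₀ ν) (scale g f b t₀ ν) (connU f g a b t₀ ν)
      (connV f g a b t₀ ν) (fun p => f (ν p) * scale f g a t₀ ν p)
      (fun p => g (ν p) * scale g f b t₀ ν p) x (frameX ε x) (frameY δ x) (normal ε δ x) D := by
  have hD := h.isOpen
  have hpr := hx.1.isPrincipal
  have hinv := hx.2
  have hα : ∀ p ∈ D, du x p = scale f g a t₀ ν p • frameX ε x p := fun p hp => by
    rw [← h.sqrt_coeffE hx hp]; exact hpr.du_eq_smul_frameX hp
  have hβ : ∀ p ∈ D, dv x p = scale g f b t₀ ν p • frameY δ x p := fun p hp => by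
    rw [← h.sqrt_coeffG hx hp]; exact hpr.dv_eq_smul_frameY hp
  have duN : ∀ p ∈ D, du (normal ε δ x) p =
      -((f (ν p) * scale f g a t₀ ν p) • frameX ε x p) := fun p hp => by
    rw [hpr.du_normal hD hp, hinv.nu1_eq p hp, hα p hp, smul_smul]
  have dvN : ∀ p ∈ D, dv (normal ε δ x) p =
      -((g (ν p) * scale g f b t₀ ν p) • frameY δ x p) := fun p hp => by
    rw [hpr.dv_normal hD hp, hinv.nu2_eq p hp, hβ p hp, smul_smul]
  have o := fun p (hp : p ∈ D) => hpr.isRightFrame hp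
  have dX := fun p (hp : p ∈ D) => hpr.diff_frameX hD hp
  have dY := fun p (hp : p ∈ D) => hpr.diff_frameY hD hp
  have dN := fun p (hp : p ∈ D) => hpr.diff_normal hD hp
  -- This is x_uv = x_vu in terms of the frame. Its Y component yields ⟨X_v, Y⟩ and its X component
  -- yields ⟨Y_u, X⟩, so the connection form is determined by the metric.
  have mixed : ∀ p ∈ D, scale f g a t₀ ν p • dv (frameX ε x) p +
      (-(scale g f b t₀ ν p * connU f g a b t₀ ν p)) • frameX ε x p =
      scale g f b t₀ ν p • du (frameY δ x) p +
      (scale f g a t₀ ν p * connV f g a b t₀ ν p) • frameY δ x p := by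
    intro p hp
    have := hpr.dv_du_comm hD hp
    rwa [dv_congr_on hD hα hp, du_congr_on hD hβ hp, dv_smul (h.diff_α hp) (dX p hp),
      du_smul (h.diff_β hp) (dY p hp), h.dv_α hp, h.du_β hp] at this
  have uXX : ∀ p ∈ D, (inner ℝ (du (frameX ε x) p) (frameX ε x p) : ℝ) = 0 := fun p hp => by
    have := inner_du_eq_neg (c := 1) hD hp (dX p hp) (dX p hp) fun q hq => (o q hq).inner_XX
    linarith
  have vXX : ∀ p ∈ D, (inner ℝ (dv (frameX ε x) p) (frameX ε x p) : ℝ) = 0 := fun p hp => by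
    have := inner_dv_eq_neg (c := 1) hD hp (dX p hp) (dX p hp) fun q hq => (o q hq).inner_XX
    linarith
  have uYY : ∀ p ∈ D, (inner ℝ (du (frameY δ x) p) (frameY δ x p) : ℝ) = 0 := fun p hp => by
    have := inner_du_eq_neg (c := 1) hD hp (dY p hp) (dY p hp) fun q hq => (o q hq).inner_YY
    linarith
  have vYY : ∀ p ∈ D, (inner ℝ (dv (frameY δ x) p) (frameY δ x p) : ℝ) = 0 := fun p hp => by
    have := inner_dv_eq_neg (c := 1) hD hp (dY p hp) (dY p hp) fun q hq => (o q hq).inner_YY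
    linarith
  have vXY : ∀ p ∈ D, (inner ℝ (dv (frameX ε x) p) (frameY δ x p) : ℝ) =
      connV f g a b t₀ ν p := fun p hp => by
    have key := congrArg (fun z => (inner ℝ z (frameY δ x p) : ℝ)) (mixed p hp)
    simp only [inner_add_left, real_inner_smul_left, uYY p hp, (o p hp).inner_XY,
      (o p hp).inner_YY] at key
    exact mul_left_cancel₀ (scale_ne_zero h.ha p) (by linear_combination key)
  have uYX : ∀ p ∈ D, (inner ℝ (du (frameY δ x) p) (frameX ε x p) : ℝ) =
      -connU f g a b t₀ ν p := fun p hp => by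
    have key := congrArg (fun z => (inner ℝ z (frameX ε x p) : ℝ)) (mixed p hp)
    simp only [inner_add_left, real_inner_smul_left, vXX p hp, (o p hp).inner_XX,
      (o p hp).inner_YX] at key
    exact mul_left_cancel₀ (scale_ne_zero h.hb p) (by linear_combination -key)
  have uXY : ∀ p ∈ D, (inner ℝ (du (frameX ε x) p) (frameY δ x p) : ℝ) =
      connU f g a b t₀ ν p := fun p hp => by
    rw [inner_du_eq_neg (c := 0) hD hp (dX p hp) (dY p hp) fun q hq => (o q hq).inner_XY,
      uYX p hp, neg_neg]
  have vYX : ∀ p ∈ D, (inner ℝ (dv (frameY δ x) p) (frameX ε x p) : ℝ) =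
      -connV f g a b t₀ ν p := fun p hp => by
    rw [inner_dv_eq_neg (c := 0) hD hp (dY p hp) (dX p hp) fun q hq => (o q hq).inner_YX,
      vXY p hp]
  have uXN : ∀ p ∈ D, (inner ℝ (du (frameX ε x) p) (normal ε δ x p) : ℝ) =
      f (ν p) * scale f g a t₀ ν p := fun p hp => by
    rw [inner_du_eq_neg (c := 0) hD hp (dX p hp) (dN p hp) fun q hq => (o q hq).inner_XN,
      duN p hp, inner_neg_left, real_inner_smul_left, (o p hp).inner_XX]
    ring
  have vXN : ∀ p ∈ D, (inner ℝ (dv (frameX ε x) p) (normal ε δ x p) : ℝ) = 0 := fun p hp => by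
    rw [inner_dv_eq_neg (c := 0) hD hp (dX p hp) (dN p hp) fun q hq => (o q hq).inner_XN,
      dvN p hp, inner_neg_left, real_inner_smul_left, (o p hp).inner_YX]
    ring
  have uYN : ∀ p ∈ D, (inner ℝ (du (frameY δ x) p) (normal ε δ x p) : ℝ) = 0 := fun p hp => by
    rw [inner_du_eq_neg (c := 0) hD hp (dY p hp) (dN p hp) fun q hq => (o q hq).inner_YN,
      duN p hp, inner_neg_left, real_inner_smul_left, (o p hp).inner_XY]
    ring
  have vYN : ∀ p ∈ D, (inner ℝ (dv (frameY δ x) p) (normal ε δ x p) : ℝ) =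
      g (ν p) * scale g f b t₀ ν p := fun p hp => by
    rw [inner_dv_eq_neg (c := 0) hD hp (dY p hp) (dN p hp) fun q hq => (o q hq).inner_YN,
      dvN p hp, inner_neg_left, real_inner_smul_left, (o p hp).inner_YY]
    ring
  exact
    { isOpen := hD
      diff_α := fun p hp => h.diff_α hp
      diff_β := fun p hp => h.diff_β hp
      du_eq := hα
      dv_eq := hβ
      dv_α := fun p hp => h.dv_α hp
      du_β := fun p hp => h.du_β hp
      frame :=
        { diffX := dX
          diffY := dY
          diffN := dN
          du_X := fun p hp => by
            rw [(o p hp).eq_combination (uXX p hp) (uXY p hp) (uXN p hp), zero_smul, zero_add]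
          du_Y := fun p hp => by
            rw [(o p hp).eq_combination (uYX p hp) (uYY p hp) (uYN p hp), zero_smul, zero_smul,
              add_zero, add_zero, neg_smul]
          du_N := duN
          dv_X := fun p hp => by
            rw [(o p hp).eq_combination (vXX p hp) (vXY p hp) (vXN p hp), zero_smul, zero_smul,
              zero_add, add_zero]
          dv_Y := fun p hp => by
            rw [(o p hp).eq_combination (vYX p hp) (vYY p hp) (vYN p hp), zero_smul, add_zero,
              neg_smul]
          dv_N := dvN }
      ortho := o }

/-- Solutions over a connected domain differ by a motion. -/
theorem IsPrescription.differByMotion (h : IsPrescription f g I a b t₀ ν D) (hc : IsConnected D)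
    (hx : IsSolution 2 f g a b t₀ ν ε δ x D) (hy : IsSolution 2 f g a b t₀ ν ε' δ' y D) :
    DifferByMotion x y D := by
  have ax := h.isAdapted hx
  have ay := h.isAdapted hy
  obtain ⟨A, hA, hAXY⟩ := ax.frame.exists_rotation h.isOpen hc ay.frame ax.ortho ay.ortho
  set T : E3 →L[ℝ] E3 := (Matrix.toEuclideanLin A).toContinuousLinearMap with hT
  have hTa : ∀ z, T z = Matrix.toEuclideanLin A z := fun z => rfl
  have dx := fun p (hp : p ∈ D) => hx.1.isPrincipal.diff_x h.isOpen hp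
  have dy := fun p (hp : p ∈ D) => hy.1.isPrincipal.diff_x h.isOpen hp
  have dTx : ∀ p ∈ D, DifferentiableAt ℝ (fun q => T (x q)) p := fun p hp =>
    T.differentiableAt.comp p (dx p hp)
  -- Both immersions have the same factors α and β, and T carries one frame to the other, so y - Tx
  -- has vanishing derivative.
  obtain ⟨c, hc⟩ := exists_const_of_du_dv_eq_zero (h := fun p => y p - T (x p)) h.isOpen
    hc.isPreconnected (fun p hp => ((dy p hp).sub (dTx p hp)).differentiableWithinAt)
    (fun p hp => by
      rw [du_sub (dy p hp) (dTx p hp), du_clm_comp T (dx p hp), ax.du_eq p hp, ay.du_eq p hp,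
        map_smul, hTa, (hAXY p hp).1, sub_self])
    (fun p hp => by
      rw [dv_sub (dy p hp) (dTx p hp), dv_clm_comp T (dx p hp), ax.dv_eq p hp, ay.dv_eq p hp,
        map_smul, hTa, (hAXY p hp).2, sub_self])
  refine ⟨A, hA, c, fun p hp => ?_⟩
  rw [← hTa, ← hc p hp, add_sub_cancel]

/-- The principal parameters of a solution are geometric. -/
theorem IsPrescription.isGeometric (h : IsPrescription f g I a b t₀ ν D)
    (hx : IsSolution 2 f g a b t₀ ν ε δ x D) : IsGeometric f g t₀ ν x D := by
  have ax := h.isAdapted hx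
  refine ⟨⟨Real.log |a⁻¹|, fun p hp => ?_⟩, Real.log |b⁻¹|, fun p hp => ?_⟩
  · have hP := expInt_pos f g t₀ (ν p)
    rw [lambdaFun, ax.sqrt_coeffE hp, scale, mul_inv, abs_mul, abs_of_pos (inv_pos.2 hP),
      mul_assoc, inv_mul_cancel₀ hP.ne', mul_one]
  · have hP := expInt_pos g f t₀ (ν p)
    rw [muFun, ax.sqrt_coeffG hp, scale, mul_inv, abs_mul, abs_of_pos (inv_pos.2 hP),
      mul_assoc, inv_mul_cancel₀ hP.ne', mul_one]

end Converse

end WeingartenSurface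

end

theorem theorem4p8 (n : ℕ∞) (hn : 2 ≤ n)
    (I : Set ℝ) (hIo : IsOpen I) (hIc : I.OrdConnected)
    (f g : ℝ → ℝ) (hf : ContDiffOn ℝ n f I) (hg : ContDiffOn ℝ n g I)
    (hfg : ∀ t ∈ I, 0 < f t - g t) (hfg' : ∀ t ∈ I, deriv f t * deriv g t ≠ 0)
    (D : Set (ℝ × ℝ)) (hD : IsOpen D)
    (ν : ℝ × ℝ → ℝ) (hν : ContDiffOn ℝ n ν D) (hνI : ∀ p ∈ D, ν p ∈ I)
    (hνuv : ∀ p ∈ D, WeingartenSurface.du ν p * WeingartenSurface.dv ν p ≠ 0)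
    (p₀ : ℝ × ℝ) (hp₀ : p₀ ∈ D) (a b : ℝ) (ha : a ≠ 0) (hb : b ≠ 0)
    (hpde : ∀ p ∈ D, WeingartenSurface.GeometricPDE f g a b (ν p₀) ν p) :
    -- existence in a neighbourhood of the base point
    (∃ D₀ : Set (ℝ × ℝ), IsOpen D₀ ∧ IsConnected D₀ ∧ p₀ ∈ D₀ ∧ D₀ ⊆ D ∧
      ∃ x : ℝ × ℝ → WeingartenSurface.E3,
        WeingartenSurface.IsSolution n f g a b (ν p₀) ν (Real.sign a) (Real.sign b) x D₀) ∧
    -- uniqueness up to a motion, over every connected domain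
    (∀ D₁ : Set (ℝ × ℝ), IsOpen D₁ → IsConnected D₁ → D₁ ⊆ D →
      ∀ (ε δ ε' δ' : ℝ) (x y : ℝ × ℝ → WeingartenSurface.E3),
        WeingartenSurface.IsSolution 2 f g a b (ν p₀) ν ε δ x D₁ →
        WeingartenSurface.IsSolution 2 f g a b (ν p₀) ν ε' δ' y D₁ →
        WeingartenSurface.DifferByMotion x y D₁) ∧
    -- the parameters are geometric principal parameters
    (∀ D₁ : Set (ℝ × ℝ), IsOpen D₁ → IsConnected D₁ → D₁ ⊆ D →
      ∀ (ε δ : ℝ) (x : ℝ × ℝ → WeingartenSurface.E3),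
        WeingartenSurface.IsSolution 2 f g a b (ν p₀) ν ε δ x D₁ →
        WeingartenSurface.IsGeometric f g (ν p₀) ν x D₁) := by
  have hn2 : (2 : WithTop ℕ∞) ≤ n := WithTop.coe_le_coe.2 hn
  have h : WeingartenSurface.IsPrescription f g I a b (ν p₀) ν D :=
    { isOpen_I := hIo
      ordConnected := hIc
      contDiff_f := hf.of_le hn2
      contDiff_g := hg.of_le hn2
      ne := fun t ht => (hfg t ht).ne'
      deriv_f_ne := fun t ht => left_ne_zero_of_mul (hfg' t ht)
      deriv_g_ne := fun t ht => right_ne_zero_of_mul (hfg' t ht)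
      mem_t₀ := hνI p₀ hp₀
      isOpen := hD
      contDiff_ν := hν.of_le hn2
      mapsTo := hνI
      du_ne := fun p hp => left_ne_zero_of_mul (hνuv p hp)
      dv_ne := fun p hp => right_ne_zero_of_mul (hνuv p hp)
      ha := ha
      hb := hb }
  refine ⟨?_, fun D₁ ho hc hs ε δ ε' δ' x y hx hy => (h.mono ho hs).differByMotion hc hx hy,
    fun D₁ ho _ hs ε δ x hx => (h.mono ho hs).isGeometric hx⟩
  obtain ⟨ρ, hρ, hsub, x, hx⟩ := h.exists_solution hn hf hg hν hpde hp₀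
  exact ⟨Metric.ball p₀ ρ, Metric.isOpen_ball,
    (convex_ball p₀ ρ).isConnected ⟨p₀, Metric.mem_ball_self hρ⟩, Metric.mem_ball_self hρ, hsub,
    x, hx⟩
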